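/- Let $n\ge 0$, let $d_1,\dots,d_n,d\in\mathbb Z$, $\zeta\in\mathbb T$, and let $V=\mathbb C^n$ carry the unitary representation $\pi$ of $\mathbb T$ with $\pi_w(e_i)=w^{d_i}e_i$. Let $\omega=\sum_{i,j}\omega_{ij}\,e_i\otimes e_j\in V\otimes V$ be $d$-homogeneous ($\omega_{ij}=0$ unless $d_i+d_j=d$), and assume that there is $c\in\mathbb C^\times$ with $\sum_k\overline{\omega_{ik}}\,\omega_{kj}=c\,\zeta^{d\,d_i}\delta_{ij}$ for all $i,j$. Let $B=A_o(V,\pi,\omega)$ be the universal unital C*-algebra with generators $u_{ij}$, $1\le i,j\le n$, and relations $$\sum_k u_{ki}^*u_{kj}=\delta_{ij},\qquad \sum_k u_{ik}u_{jk}^*=\delta_{ij},\qquad \zeta^{d_jd_i}\sum_k\omega_{ik}u_{jk}=\zeta^{d_j(d-d_j)}\sum_k\omega_{kj}u_{ki}^*,\tag{1}$$ with the $\mathbb T$-action $\beta_w(u_{ij})=w^{d_j-d_i}u_{ij}$. Braided tensor products: let $\mathcal K,\mathcal L$ be Hilbert spaces with orthonormal bases $(\delta_k)$, $(\lambda_m)$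 of vectors of degrees $p_k,l_m\in\mathbb Z$, and let $S\subseteq\mathbb B(\mathcal K)$, $T\subseteq\mathbb B(\mathcal L)$ be star algebras of operators. Then $S\boxtimes_\zeta T\subseteq\mathbb B(\mathcal K\otimes\mathcal L)$ is the C*-algebra generated by $j_1(a)=a\otimes1$ for $a\in S$ and $j_2(b)=X(b\otimes1)X^*$ for $b\in T$, where $X\colon\mathcal L\otimes\mathcal K\to\mathcal K\otimes\mathcal L$, $X(\lambda_m\otimes\delta_k)=\zeta^{l_mp_k}\,\delta_k\otimes\lambda_m$. Degrees add in tensor products of Hilbert spaces, and $\otimes$ denotes the spatial tensor product of C*-algebras. Represent $C(\mathbb T)$ on $L^2(\mathbb T)$ by multiplication, where $z^k$ has degree $k$, and $B$ by a faithful unital *-representation on a Hilbert space $\mathcal L$ with an orthonormal basis of homogeneous vectors as above, equivariantly for $\beta$; such a representation exists, and any one may be used. There is a unique unital *-homomorphism $\Delta\colon B\to B\boxtimes_\zeta B$ with $\Delta(u_{ik})=\sum_l j_1(u_{il})j_2(u_{lk})$. The bosonisation $(C,\Delta_C)$ of the braided quantum group $(B,\beta,\Delta)$ is $C=C(\mathbb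 T)\boxtimes_\zeta B$ with $\Delta_C=\psi\circ(\mathrm{id}\boxtimes\Delta)\colon C\to C\otimes C$, where $\mathrm{id}\boxtimes\Delta\colon C\to C(\mathbb T)\boxtimes_\zeta(B\boxtimes_\zeta B)$ fixes the first factor and applies $\Delta$ in the second, and $\psi\colon C(\mathbb T)\boxtimes_\zeta(B\boxtimes_\zeta B)\to C\otimes C$ is the *-homomorphism with $\psi(j_1(z))=j_1(z)\otimes j_1(z)$, $\psi(j_2(b))=j_2(b)\otimes j_1(z^k)$ if $\beta_w(b)=w^kb$ for all $w\in\mathbb T$, and $\psi(j_3(b))=1\otimes j_2(b)$ for all $b\in B$; here $j_1$, $j_2$, $j_3$ on the left are the embeddings of the three factors. **Theorem.** The products $j_1(a)j_2(b)$ with $a\in C(\mathbb T)$ and $b\in B$ span a dense subspace of $C$. With $z:=j_1(z)$ and $u_{ij}:=j_2(u_{ij})$, the C*-algebra $C$ is the universal unital C*-algebra generated by elements $z$ and $u_{ij}$, $1\le i,j\le n$, subject to the relations $zz^*=1=z^*z$, the relations (1), and $z\,u_{ij}=\zeta^{d_i-d_j}\,u_{ij}\,z$ for all $i,j$. The comultiplication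 $\Delta_C$ exists, is unique, and is given by $$\Delta_C(z)=z\otimes z,\qquad \Delta_C(u_{ik})=\sum_{l=1}^n u_{il}\otimes z^{d_l-d_i}u_{lk}.$$ -/

import Mathlib

universe u v

noncomputable section

namespace BraidedFree

/-! ### Free unital star algebras -/

/-- A complex algebra with scalar multiplication twisted by complex conjugation, and opposite
multiplication; the target of the involution of the free star algebra. -/
def ConjOp (A : Type*) := Aᵐᵒᵖ

instance (A : Type*) [Ring A] : Ring (ConjOp A) := inferInstanceAs (Ring Aᵐᵒᵖ)

instance (A : Type*) [Ring A] [Algebra ℂ A] : Algebra ℂ (ConjOp A) :=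
  RingHom.toAlgebra' ((algebraMap ℂ Aᵐᵒᵖ).comp (starRingEnd ℂ))
    fun c x => Algebra.commutes (A := Aᵐᵒᵖ) (starRingEnd ℂ c) x

/-- The free unital complex star algebra on a type `X` of generators: noncommutative polynomials
in the letters `Sum.inl x` (standing for `x`) and `Sum.inr x` (standing for the adjoint of `x`). -/
def FreeStar (X : Type*) := FreeAlgebra ℂ (X ⊕ X)

variable {X : Type*}

instance : Ring (FreeStar X) := inferInstanceAs (Ring (FreeAlgebra ℂ (X ⊕ X)))

instance : Algebra ℂ (FreeStar X) := inferInstanceAs (Algebra ℂ (FreeAlgebra ℂ (X ⊕ X)))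

namespace FreeStar

/-- The letters. -/
def letter (x : X ⊕ X) : FreeStar X := FreeAlgebra.ι ℂ x

/-- The generators. -/
def gen (x : X) : FreeStar X := letter (Sum.inl x)

/-- The involution as a homomorphism to the conjugate opposite algebra. -/
def starAux : FreeStar X →ₐ[ℂ] ConjOp (FreeStar X) :=
  FreeAlgebra.lift ℂ (A := ConjOp (FreeStar X)) fun x => MulOpposite.op (letter x.swap)

/-- The involution: antimultiplicative, conjugate-linear, exchanging the two letters of
each generator. -/
def starFun (a : FreeStar X) : FreeStar X := MulOpposite.unop (starAux a : (FreeStar X)ᵐᵒᵖ)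

theorem starFun_letter (x : X ⊕ X) : starFun (letter x) = letter x.swap := by
  have : starAux (letter x) = (MulOpposite.op (letter x.swap) : (FreeStar X)ᵐᵒᵖ) :=
    FreeAlgebra.lift_ι_apply (A := ConjOp (FreeStar X)) _ x
  simp [starFun, this]

theorem starFun_add (a b : FreeStar X) : starFun (a + b) = starFun a + starFun b := by
  unfold starFun; rw [map_add]; rfl

theorem starFun_mul (a b : FreeStar X) : starFun (a * b) = starFun b * starFun a := by
  unfold starFun; rw [map_mul]; rfl

theorem starFun_algebraMap (c : ℂ) :
    starFun (algebraMap ℂ (FreeStar X) c) = algebraMap ℂ (FreeStar X) (starRingEnd ℂ c) := by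
  unfold starFun; rw [AlgHom.commutes]; rfl

theorem induct {P : FreeStar X → Prop} (h1 : ∀ c, P (algebraMap ℂ _ c)) (h2 : ∀ x, P (letter x))
    (h3 : ∀ a b, P a → P b → P (a * b)) (h4 : ∀ a b, P a → P b → P (a + b)) (a : FreeStar X) :
    P a :=
  FreeAlgebra.induction ℂ (X ⊕ X) h1 h2 h3 h4 a

instance : StarRing (FreeStar X) where
  star := starFun
  star_involutive a := by
    induction a using induct with
    | h1 c => simp [starFun_algebraMap]
    | h2 x => simp [starFun_letter]
    | h3 a b ha hb => simp [starFun_mul, ha, hb]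
    | h4 a b ha hb => simp [starFun_add, ha, hb]
  star_mul := starFun_mul
  star_add := starFun_add

theorem star_letter (x : X ⊕ X) : star (letter x) = letter x.swap := starFun_letter x

theorem star_algebraMap (c : ℂ) :
    star (algebraMap ℂ (FreeStar X) c) = algebraMap ℂ (FreeStar X) (star c) :=
  starFun_algebraMap c

instance : StarModule ℂ (FreeStar X) where
  star_smul c a := by rw [Algebra.smul_def, star_mul, star_algebraMap, Algebra.smul_def,
    Algebra.commutes]

variable {D : Type*} [Ring D] [StarRing D] [Algebra ℂ D]

/-- Evaluation of noncommutative star polynomials, as an algebra homomorphism. -/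
def evalAlg (g : X → D) : FreeStar X →ₐ[ℂ] D :=
  FreeAlgebra.lift ℂ (Sum.elim g fun x => star (g x))

theorem evalAlg_letter (g : X → D) (x : X ⊕ X) :
    evalAlg g (letter x) = Sum.elim g (fun x => star (g x)) x :=
  FreeAlgebra.lift_ι_apply _ x

/-- Evaluation of noncommutative star polynomials at a family of elements. -/
def eval [StarModule ℂ D] (g : X → D) : FreeStar X →⋆ₐ[ℂ] D :=
  { evalAlg g with
    map_star' := fun a => by
      change evalAlg g (star a) = star (evalAlg g a)
      induction a using induct with
      | h1 c => rw [star_algebraMap, AlgHom.commutes, AlgHom.commutes, algebraMap_star_comm]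
      | h2 x =>
        rw [star_letter, evalAlg_letter, evalAlg_letter]
        rcases x with x | x <;> simp
      | h3 a b ha hb => rw [star_mul, map_mul, ha, hb, ← star_mul, map_mul]
      | h4 a b ha hb => rw [star_add, map_add, ha, hb, ← star_add, map_add] }

theorem eval_gen [StarModule ℂ D] (g : X → D) (x : X) : eval g (gen x) = g x :=
  evalAlg_letter g (Sum.inl x)

theorem hom_ext {φ ψ : FreeStar X →⋆ₐ[ℂ] D} (h : ∀ x, φ (gen x) = ψ (gen x)) : φ = ψ := by
  ext a
  induction a using induct with
  | h1 c => exact (AlgHomClass.commutes φ c).trans (AlgHomClass.commutes ψ c).symm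
  | h2 x =>
    rcases x with x | x
    · exact h x
    · have : (letter (Sum.inr x) : FreeStar X) = star (gen x) := (star_letter (Sum.inl x)).symm
      rw [this, map_star, map_star, h]
  | h3 a b ha hb => rw [map_mul, map_mul, ha, hb]
  | h4 a b ha hb => rw [map_add, map_add, ha, hb]

end FreeStar

/-! ### C*-seminorms and their completions -/

/-- A C*-seminorm on a unital complex star algebra. -/
structure CStarSeminorm (A : Type*) [Ring A] [StarRing A] [Algebra ℂ A] extends
    Seminorm ℂ A where
  mul_le' : ∀ a b, toSeminorm (a * b) ≤ toSeminorm a * toSeminorm b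
  cstar' : ∀ a, toSeminorm (star a * a) = toSeminorm a * toSeminorm a

namespace CStarSeminorm

variable {A : Type*} [Ring A] [StarRing A] [Algebra ℂ A]

/-- The algebra `A`, equipped with the seminorm `p`. -/
def Space (_p : CStarSeminorm A) : Type _ := A

variable (p : CStarSeminorm A)

theorem le_star (a : A) : p.toSeminorm a ≤ p.toSeminorm (star a) := by
  have h : p.toSeminorm a * p.toSeminorm a ≤ p.toSeminorm (star a) * p.toSeminorm a :=
    (p.cstar' a).symm.trans_le (p.mul_le' _ _)
  rcases (apply_nonneg p.toSeminorm a).eq_or_lt with h0 | h0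
  · rw [← h0]; exact apply_nonneg _ _
  · exact le_of_mul_le_mul_right h h0

theorem map_star_eq (a : A) : p.toSeminorm (star a) = p.toSeminorm a :=
  le_antisymm (by simpa using p.le_star (star a)) (p.le_star a)

instance : Ring p.Space := inferInstanceAs (Ring A)
instance : StarRing p.Space := inferInstanceAs (StarRing A)
instance : Algebra ℂ p.Space := inferInstanceAs (Algebra ℂ A)
instance [StarModule ℂ A] : StarModule ℂ p.Space := inferInstanceAs (StarModule ℂ A)

instance : SeminormedRing p.Space :=
  { (inferInstance : Ring p.Space),
    (p.toSeminorm.toAddGroupSeminorm.toSeminormedAddCommGroup : SeminormedAddCommGroup A) with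
    norm_mul_le := p.mul_le' }

theorem norm_def (a : p.Space) : ‖a‖ = p.toSeminorm a := rfl

instance : NormedSpace ℂ p.Space where
  norm_smul_le c a := (map_smul_eq_mul p.toSeminorm c a).le

theorem norm_star_eq (a : p.Space) : ‖star a‖ = ‖a‖ := p.map_star_eq a

/-- The completion of `A` (or rather, of its Hausdorff quotient) in the seminorm `p`. -/
abbrev Compl : Type _ := UniformSpace.Completion p.Space

theorem uniformContinuous_star : UniformContinuous (star : p.Space → p.Space) := by
  have : Isometry (starAddEquiv : p.Space ≃+ p.Space) :=
    AddMonoidHomClass.isometry_of_norm _ fun a => p.norm_star_eq a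
  exact this.uniformContinuous

instance : Star p.Compl := ⟨UniformSpace.Completion.map star⟩

theorem coe_star (a : p.Space) : (star (a : p.Compl)) = ((star a : p.Space) : p.Compl) :=
  UniformSpace.Completion.map_coe p.uniformContinuous_star a

theorem continuous_star' : Continuous (star : p.Compl → p.Compl) :=
  UniformSpace.Completion.continuous_map

instance : StarRing p.Compl where
  star_involutive x := by
    induction x using UniformSpace.Completion.induction_on with
    | hp => exact isClosed_eq (p.continuous_star'.comp p.continuous_star') continuous_id
    | ih a => rw [coe_star, coe_star, star_star]
  star_mul x y := by
    induction x, y using UniformSpace.Completion.induction_on₂ with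
    | hp =>
      exact isClosed_eq (p.continuous_star'.comp (continuous_fst.mul continuous_snd))
        ((p.continuous_star'.comp continuous_snd).mul (p.continuous_star'.comp continuous_fst))
    | ih a b =>
      rw [← UniformSpace.Completion.coe_mul, coe_star, coe_star, coe_star, star_mul,
        UniformSpace.Completion.coe_mul]
  star_add x y := by
    induction x, y using UniformSpace.Completion.induction_on₂ with
    | hp =>
      exact isClosed_eq (p.continuous_star'.comp (continuous_fst.add continuous_snd))
        ((p.continuous_star'.comp continuous_fst).add (p.continuous_star'.comp continuous_snd))
    | ih a b =>
      rw [← UniformSpace.Completion.coe_add, coe_star, coe_star, coe_star, star_add,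
        UniformSpace.Completion.coe_add]

instance : NormedAlgebra ℂ p.Compl where
  __ := (inferInstance : Algebra ℂ p.Compl)
  norm_smul_le := norm_smul_le

instance : CStarRing p.Compl where
  norm_mul_self_le x := by
    induction x using UniformSpace.Completion.induction_on with
    | hp =>
      exact isClosed_le (continuous_norm.mul continuous_norm)
        (continuous_norm.comp (p.continuous_star'.mul continuous_id))
    | ih a =>
      rw [coe_star, ← UniformSpace.Completion.coe_mul, UniformSpace.Completion.norm_coe,
        UniformSpace.Completion.norm_coe]
      exact (p.cstar' a).ge

instance [StarModule ℂ A] : StarModule ℂ p.Compl where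
  star_smul c x := by
    induction x using UniformSpace.Completion.induction_on with
    | hp =>
      exact isClosed_eq (p.continuous_star'.comp (continuous_const_smul c))
        ((continuous_const_smul (star c)).comp p.continuous_star')
    | ih a =>
      rw [← UniformSpace.Completion.coe_smul, coe_star, coe_star, star_smul,
        UniformSpace.Completion.coe_smul]

instance [StarModule ℂ A] : CStarAlgebra p.Compl where

/-- The canonical map to the completion. -/
def incl (a : A) : p.Compl := UniformSpace.Completion.coe' (α := p.Space) a

/-- The canonical homomorphism to the completion. -/
def toCompl : A →⋆ₐ[ℂ] p.Compl where
  toFun := p.incl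
  map_one' := UniformSpace.Completion.coe_one p.Space
  map_mul' := UniformSpace.Completion.coe_mul (α := p.Space)
  map_zero' := UniformSpace.Completion.coe_zero (α := p.Space)
  map_add' := UniformSpace.Completion.coe_add (α := p.Space)
  commutes' _ := rfl
  map_star' a := (p.coe_star a).symm

theorem norm_toCompl (a : A) : ‖p.toCompl a‖ = p.toSeminorm a :=
  UniformSpace.Completion.norm_coe (E := p.Space) a

theorem denseRange_toCompl : DenseRange p.toCompl :=
  UniformSpace.Completion.denseRange_coe (α := p.Space)

/-- A star homomorphism to a C*-algebra dominated by `p` extends to the completion. -/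
theorem exists_extension {D : Type*} [CStarAlgebra D] (φ : A →⋆ₐ[ℂ] D)
    (h : ∀ a, ‖φ a‖ ≤ p.toSeminorm a) : ∃ Φ : p.Compl →⋆ₐ[ℂ] D, ∀ a, Φ (p.toCompl a) = φ a := by
  let f : p.Space →+* D := (φ : A →+* D)
  have hf : Continuous f :=
    AddMonoidHomClass.continuous_of_bound f 1 fun a => by rw [one_mul]; exact h a
  let F := UniformSpace.Completion.extensionHom f hf
  have hF : Continuous F := UniformSpace.Completion.continuous_extension
  have hFc : ∀ a : p.Space, F (a : p.Compl) = φ a :=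
    UniformSpace.Completion.extensionHom_coe f hf
  let Φ : p.Compl →⋆ₐ[ℂ] D :=
    { F with
      commutes' := fun c => (hFc (algebraMap ℂ A c)).trans (AlgHomClass.commutes φ c)
      map_star' := fun x => by
        change F (star x) = star (F x)
        induction x using UniformSpace.Completion.induction_on with
        | hp => exact isClosed_eq (hF.comp p.continuous_star') (continuous_star.comp hF)
        | ih a => rw [coe_star, hFc, hFc]; exact map_star φ a }
  exact ⟨Φ, hFc⟩

/-- The C*-seminorm pulled back from a C*-algebra. -/
def ofHom {D : Type*} [CStarAlgebra D] (φ : A →⋆ₐ[ℂ] D) : CStarSeminorm A where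
  toFun a := ‖φ a‖
  map_zero' := by simp
  add_le' a b := by rw [map_add]; exact norm_add_le _ _
  neg' a := by rw [map_neg, norm_neg]
  smul' c a := by rw [map_smul, norm_smul]
  mul_le' a b := by
    change ‖φ (a * b)‖ ≤ ‖φ a‖ * ‖φ b‖
    rw [map_mul]; exact norm_mul_le _ _
  cstar' a := by
    change ‖φ (star a * a)‖ = ‖φ a‖ * ‖φ a‖
    rw [map_mul, map_star, CStarRing.norm_star_mul_self]

/-- The zero C*-seminorm. -/
def zero (A : Type*) [Ring A] [StarRing A] [Algebra ℂ A] : CStarSeminorm A where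
  toSeminorm := 0
  mul_le' a b := by simp
  cstar' a := by simp

/-- The C*-seminorms that vanish on a set of relators. -/
abbrev Vanishing (R : Set A) : Type _ := {p : CStarSeminorm A // ∀ x ∈ R, p.toSeminorm x = 0}

instance (R : Set A) : Nonempty (Vanishing R) := ⟨⟨zero A, fun _ _ => rfl⟩⟩

/-- The largest C*-seminorm that vanishes on a given set of relators, provided that the
C*-seminorms that vanish on the relators are pointwise bounded. -/
def largest (R : Set A) (hb : ∀ a, BddAbove (Set.range fun p : Vanishing R => p.1.toSeminorm a)) :
    CStarSeminorm A where
  toFun a := ⨆ p : Vanishing R, p.1.toSeminorm a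
  map_zero' := by simp
  add_le' a b := ciSup_le fun p => (map_add_le_add p.1.toSeminorm a b).trans
    (add_le_add (le_ciSup (hb a) p) (le_ciSup (hb b) p))
  neg' a := by simp
  smul' c a := by simp only [map_smul_eq_mul]; rw [Real.mul_iSup_of_nonneg (norm_nonneg c)]
  mul_le' a b := ciSup_le fun p => (p.1.mul_le' a b).trans
    (mul_le_mul (le_ciSup (hb a) p) (le_ciSup (hb b) p) (apply_nonneg _ _)
      (Real.iSup_nonneg fun _ => apply_nonneg _ _))
  cstar' a := by
    apply le_antisymm
    · refine ciSup_le fun p => (p.1.cstar' a).le.trans ?_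
      exact mul_le_mul (le_ciSup (hb a) p) (le_ciSup (hb a) p) (apply_nonneg _ _)
        (Real.iSup_nonneg fun _ => apply_nonneg _ _)
    · change (⨆ p : Vanishing R, p.1.toSeminorm a) * (⨆ p : Vanishing R, p.1.toSeminorm a) ≤
        ⨆ p : Vanishing R, p.1.toSeminorm (star a * a)
      rw [Real.mul_iSup_of_nonneg (Real.iSup_nonneg fun _ => apply_nonneg _ _)]
      refine ciSup_le fun p => ?_
      rw [mul_comm, Real.mul_iSup_of_nonneg (apply_nonneg _ _)]
      refine ciSup_le fun q => ?_
      have hp := (p.1.cstar' a).symm.le.trans (le_ciSup (hb (star a * a)) p)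
      have hq := (q.1.cstar' a).symm.le.trans (le_ciSup (hb (star a * a)) q)
      have h1 := apply_nonneg p.1.toSeminorm a
      have h2 := apply_nonneg q.1.toSeminorm a
      rcases le_total (p.1.toSeminorm a) (q.1.toSeminorm a) with h | h
      · exact (mul_le_mul_of_nonneg_right h h2).trans hq
      · exact (mul_le_mul_of_nonneg_left h h1).trans hp

end CStarSeminorm
/-! ### Operators on `ℓ²` spaces -/

/-- The Hilbert space `ℓ²(ι)`. The Hilbert space tensor product of `ℓ²(ι)` and `ℓ²(κ)` is
`ℓ²(ι × κ)`. -/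
abbrev L2 (ι : Type*) : Type _ := lp (fun _ : ι => ℂ) 2

/-- The C*-algebra of bounded operators on `ℓ²(ι)`. -/
abbrev Op (ι : Type*) : Type _ := L2 ι →L[ℂ] L2 ι

theorem summable_sq {ι : Type*} (f : L2 ι) : Summable fun i => ‖f i‖ ^ 2 := by
  simpa using (lp.memℓp f).summable (by norm_num)

theorem norm_sq_eq {ι : Type*} (f : L2 ι) : ‖f‖ ^ 2 = ∑' i, ‖f i‖ ^ 2 := by
  simpa using lp.norm_rpow_eq_tsum (p := 2) (by norm_num) f

theorem memL2 {ι : Type*} {f : ι → ℂ} (h : Summable fun i => ‖f i‖ ^ 2) :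
    Memℓp (E := fun _ : ι => ℂ) f 2 :=
  memℓp_gen (by simpa using h)

section PhasePerm

variable {ι κ : Type*}

/-- The vector `∑ c(i) f(i) δ_{e(i)}`. -/
def phaseFun (e : ι ≃ κ) (c : ι → Circle) (f : L2 ι) : L2 κ :=
  ⟨fun k => (c (e.symm k) : ℂ) * f (e.symm k), memL2 (by
    simp only [norm_mul, Circle.norm_coe, one_mul]
    exact (e.symm.summable_iff (f := fun i => ‖f i‖ ^ 2)).2 (summable_sq f))⟩

theorem phaseFun_apply (e : ι ≃ κ) (c : ι → Circle) (f : L2 ι) (k : κ) :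
    phaseFun e c f k = (c (e.symm k) : ℂ) * f (e.symm k) := rfl

/-- The unitary operator `ℓ²(ι) → ℓ²(κ)` that maps the basis vector `δ_i` to `c(i) δ_{e(i)}`. -/
def phasePerm (e : ι ≃ κ) (c : ι → Circle) : L2 ι ≃ₗᵢ[ℂ] L2 κ where
  toFun := phaseFun e c
  map_add' f g := by
    ext k; simp only [phaseFun_apply, lp.coeFn_add, Pi.add_apply, mul_add]
  map_smul' a f := by
    ext k
    simp only [phaseFun_apply, lp.coeFn_smul, Pi.smul_apply, smul_eq_mul, RingHom.id_apply]
    ring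
  invFun := phaseFun e.symm fun k => (c (e.symm k))⁻¹
  left_inv f := by
    ext i
    simp only [phaseFun_apply, Equiv.symm_symm, Equiv.symm_apply_apply, ← mul_assoc,
      ← Circle.coe_mul, inv_mul_cancel, Circle.coe_one, one_mul]
  right_inv f := by
    ext i
    simp only [phaseFun_apply, Equiv.symm_symm, Equiv.apply_symm_apply, ← mul_assoc,
      ← Circle.coe_mul, mul_inv_cancel, Circle.coe_one, one_mul]
  norm_map' f := by
    refine (sq_eq_sq₀ (norm_nonneg _) (norm_nonneg _)).1 ?_
    rw [norm_sq_eq, norm_sq_eq]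
    refine Eq.trans ?_ (e.symm.tsum_eq fun i => ‖f i‖ ^ 2)
    refine tsum_congr fun k => ?_
    change ‖phaseFun e c f k‖ ^ 2 = _
    rw [phaseFun_apply, norm_mul, Circle.norm_coe, one_mul]

theorem phasePerm_single [DecidableEq ι] [DecidableEq κ] (e : ι ≃ κ) (c : ι → Circle) (i : ι) :
    phasePerm e c (lp.single 2 i 1) = lp.single 2 (e i) (c i : ℂ) := by
  ext k
  change phaseFun e c _ k = _
  rw [phaseFun_apply]
  by_cases h : k = e i
  · subst h; simp
  · have h' : e.symm k ≠ i := fun h' => h (by rw [← h', Equiv.apply_symm_apply])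
    rw [lp.single_apply_ne _ _ _ h', lp.single_apply_ne _ _ _ h, mul_zero]

/-- Conjugation of an operator by a unitary. -/
def conjOp (V : L2 ι ≃ₗᵢ[ℂ] L2 κ) (T : Op ι) : Op κ :=
  (V : L2 ι →L[ℂ] L2 κ) ∘L T ∘L (V.symm : L2 κ →L[ℂ] L2 ι)

end PhasePerm

section Amplification

variable {ι : Type*} (κ : Type*)

/-- The slice `f(·, k)` of a vector in `ℓ²(ι × κ)`. -/
def slice {κ : Type*} (f : L2 (ι × κ)) (k : κ) : L2 ι :=
  ⟨fun i => f (i, k), memL2 ((summable_sq f).comp_injective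
    (i := fun i => (i, k)) fun _ _ h => (Prod.ext_iff.1 h).1)⟩

theorem slice_apply {κ : Type*} (f : L2 (ι × κ)) (k : κ) (i : ι) : slice f k i = f (i, k) := rfl

theorem summable_slice {κ : Type*} (f : L2 (ι × κ)) : Summable fun k => ‖slice f k‖ ^ 2 := by
  have h := ((Equiv.prodComm κ ι).summable_iff (f := fun x => ‖f x‖ ^ 2)).2 (summable_sq f)
  simp only [norm_sq_eq]
  exact h.prod

theorem tsum_slice {κ : Type*} (f : L2 (ι × κ)) : ∑' k, ‖slice f k‖ ^ 2 = ‖f‖ ^ 2 := by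
  have h := ((Equiv.prodComm κ ι).summable_iff (f := fun x => ‖f x‖ ^ 2)).2 (summable_sq f)
  simp only [norm_sq_eq]
  rw [← (Equiv.prodComm κ ι).tsum_eq]
  exact h.tsum_prod.symm

variable {κ} in
theorem summable_amp (T : Op ι) (f : L2 (ι × κ)) :
    Summable fun x : ι × κ => ‖T (slice f x.2) x.1‖ ^ 2 := by
  refine ((Equiv.prodComm κ ι).summable_iff (f := fun x : ι × κ => ‖T (slice f x.2) x.1‖ ^ 2)).1 ?_
  refine (summable_prod_of_nonneg fun _ => sq_nonneg _).2 ⟨fun k => summable_sq (T (slice f k)), ?_⟩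
  change Summable fun k => ∑' i, ‖T (slice f k) i‖ ^ 2
  simp only [← norm_sq_eq]
  refine Summable.of_nonneg_of_le (fun _ => sq_nonneg _) (fun k => ?_)
    ((summable_slice f).mul_left (‖T‖ ^ 2))
  rw [← mul_pow]
  exact pow_le_pow_left₀ (norm_nonneg _) (T.le_opNorm _) 2

/-- The vector `(T ⊗ 1) f`. -/
def ampFun {κ : Type*} (T : Op ι) (f : L2 (ι × κ)) : L2 (ι × κ) :=
  ⟨fun x => T (slice f x.2) x.1, memL2 (summable_amp T f)⟩

theorem ampFun_apply {κ : Type*} (T : Op ι) (f : L2 (ι × κ)) (x : ι × κ) :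
    ampFun T f x = T (slice f x.2) x.1 := rfl

theorem slice_ampFun {κ : Type*} (T : Op ι) (f : L2 (ι × κ)) (k : κ) :
    slice (ampFun T f) k = T (slice f k) := rfl

/-- The operator `T ⊗ 1` on `ℓ²(ι × κ)`. -/
def amp (T : Op ι) : Op (ι × κ) :=
  LinearMap.mkContinuous
    { toFun := ampFun T
      map_add' := fun f g => by
        have : ∀ k, slice (f + g) k = slice f k + slice g k := fun k => rfl
        ext x; simp [ampFun_apply, this]
      map_smul' := fun a f => by
        have : ∀ k, slice (a • f) k = a • slice f k := fun k => rfl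
        ext x; simp [ampFun_apply, this] } ‖T‖ fun f => by
    refine (sq_le_sq₀ (norm_nonneg _) (by positivity)).1 ?_
    change ‖ampFun T f‖ ^ 2 ≤ _
    rw [mul_pow, ← tsum_slice, ← tsum_slice f, ← tsum_mul_left]
    refine Summable.tsum_le_tsum (fun k => ?_) (summable_slice _) ((summable_slice f).mul_left _)
    rw [slice_ampFun, ← mul_pow]
    exact pow_le_pow_left₀ (norm_nonneg _) (T.le_opNorm _) 2

theorem amp_apply {κ : Type*} (T : Op ι) (f : L2 (ι × κ)) (i : ι) (k : κ) :
    amp κ T f (i, k) = T (slice f k) i := rfl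

end Amplification
/-! ### The braided free orthogonal quantum groups -/

/-- The data defining a braided free orthogonal quantum group: a unitary representation of the
circle group on `ℂⁿ` for which the basis vector `e_i` has degree `deg i`, the braiding parameter
`ζ`, and a `d`-homogeneous vector `ω = ∑ ω_{ij} e_i ⊗ e_j` subject to the condition
`conj(ω) ω = c · diag(ζ^{d · deg i})` for some non-zero scalar `c`. -/
structure Datum (n : ℕ) where
  deg : Fin n → ℤ
  ζ : Circle
  d : ℤ
  ω : Matrix (Fin n) (Fin n) ℂ
  homogeneous : ∀ i j, ω i j ≠ 0 → deg i + deg j = d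
  condition : ∃ c : ℂ, c ≠ 0 ∧
    ω.map (starRingEnd ℂ) * ω = Matrix.diagonal fun i => c * ((ζ ^ (d * deg i) : Circle) : ℂ)

namespace Datum

variable {n : ℕ} (P : Datum n)

/-- The defining relations of the braided free orthogonal quantum group. -/
structure Relations {D : Type*} [Ring D] [StarRing D] [Algebra ℂ D]
    (u : Fin n → Fin n → D) : Prop where
  isometry : ∀ i j, ∑ k, star (u k i) * u k j = if i = j then 1 else 0
  coisometry : ∀ i j, ∑ k, u i k * star (u j k) = if i = j then 1 else 0
  invariant : ∀ i j,
    ((P.ζ ^ (P.deg j * P.deg i) : Circle) : ℂ) • ∑ k, P.ω i k • u j k =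
      ((P.ζ ^ (P.deg j * (P.d - P.deg j)) : Circle) : ℂ) • ∑ k, P.ω k j • star (u k i)

/-- The differences of the two sides of the defining relations. -/
def relator {D : Type*} [Ring D] [StarRing D] [Algebra ℂ D] (u : Fin n → Fin n → D)
    (r : Fin 3) (i j : Fin n) : D :=
  ![∑ k, star (u k i) * u k j - (if i = j then 1 else 0),
    ∑ k, u i k * star (u j k) - (if i = j then 1 else 0),
    ((P.ζ ^ (P.deg j * P.deg i) : Circle) : ℂ) • ∑ k, P.ω i k • u j k -
      ((P.ζ ^ (P.deg j * (P.d - P.deg j)) : Circle) : ℂ) • ∑ k, P.ω k j • star (u k i)] r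

theorem relations_iff {D : Type*} [Ring D] [StarRing D] [Algebra ℂ D] (u : Fin n → Fin n → D) :
    P.Relations u ↔ ∀ r i j, P.relator u r i j = 0 := by
  constructor
  · intro h r i j
    fin_cases r
    · exact sub_eq_zero.2 (h.isometry i j)
    · exact sub_eq_zero.2 (h.coisometry i j)
    · exact sub_eq_zero.2 (h.invariant i j)
  · intro h
    exact ⟨fun i j => sub_eq_zero.1 (h 0 i j), fun i j => sub_eq_zero.1 (h 1 i j),
      fun i j => sub_eq_zero.1 (h 2 i j)⟩

theorem map_relator {D E : Type*} [Ring D] [StarRing D] [Algebra ℂ D] [Ring E] [StarRing E]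
    [Algebra ℂ E] (φ : D →⋆ₐ[ℂ] E) (u : Fin n → Fin n → D) (r : Fin 3) (i j : Fin n) :
    φ (P.relator u r i j) = P.relator (fun k l => φ (u k l)) r i j := by
  fin_cases r
  · simp [relator, apply_ite φ, map_star]
  · simp [relator, apply_ite φ, map_star]
  · simp [relator, map_star]

/-- The free unital star algebra on `n²` generators. -/
abbrev Free (n : ℕ) : Type := FreeStar (Fin n × Fin n)

/-- The relators in the free unital star algebra. -/
def relators : Set (Free n) :=
  {x | ∃ r i j, x = P.relator (fun k l => FreeStar.gen (k, l)) r i j}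

theorem relations_of_vanishing (p : CStarSeminorm.Vanishing P.relators) :
    P.Relations fun k l => p.1.toCompl (FreeStar.gen (k, l)) := by
  rw [relations_iff]
  intro r i j
  rw [← map_relator, ← norm_eq_zero, CStarSeminorm.norm_toCompl]
  exact p.2 _ ⟨r, i, j, rfl⟩

theorem Relations.norm_le_one {P : Datum n} {D : Type*} [CStarAlgebra D] {u : Fin n → Fin n → D}
    (h : P.Relations u) (i j : Fin n) : ‖u i j‖ ≤ 1 := by
  let _ := CStarAlgebra.spectralOrder D
  have _ := CStarAlgebra.spectralOrderedRing D
  have h1 : star (u i j) * u i j ≤ 1 := by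
    have := h.isometry j j
    rw [if_pos rfl] at this
    rw [← this]
    exact Finset.single_le_sum (f := fun k => star (u k j) * u k j)
      (fun k _ => star_mul_self_nonneg (u k j)) (Finset.mem_univ i)
  have h2 : ‖star (u i j) * u i j‖ ≤ 1 :=
    (CStarAlgebra.norm_le_one_iff_of_nonneg _ (star_mul_self_nonneg _)).2 h1
  rw [CStarRing.norm_star_mul_self] at h2
  nlinarith [norm_nonneg (u i j)]

theorem bounded (a : Free n) :
    BddAbove (Set.range fun p : CStarSeminorm.Vanishing P.relators => p.1.toSeminorm a) := by
  suffices ∃ C, 0 ≤ C ∧ ∀ p : CStarSeminorm.Vanishing P.relators, p.1.toSeminorm a ≤ C by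
    obtain ⟨C, -, hC⟩ := this
    exact ⟨C, by rintro _ ⟨p, rfl⟩; exact hC p⟩
  induction a using FreeStar.induct with
  | h1 c =>
    refine ⟨‖c‖, norm_nonneg _, fun p => ?_⟩
    have h := p.1.cstar' 1
    rw [star_one, mul_one] at h
    have h1 : p.1.toSeminorm 1 ≤ 1 := by nlinarith [sq_nonneg (p.1.toSeminorm 1 - 1)]
    rw [Algebra.algebraMap_eq_smul_one, map_smul_eq_mul]
    exact mul_le_of_le_one_right (norm_nonneg _) h1
  | h2 x =>
    refine ⟨1, zero_le_one, fun p => ?_⟩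
    have h := fun x : Fin n × Fin n => (P.relations_of_vanishing p).norm_le_one x.1 x.2
    simp only [CStarSeminorm.norm_toCompl] at h
    rcases x with x | x
    · exact h x
    · have e : (FreeStar.letter (Sum.inr x) : Free n) = star (FreeStar.gen x) :=
        (FreeStar.star_letter (Sum.inl x)).symm
      rw [e, CStarSeminorm.map_star_eq]
      exact h x
  | h3 a b ha hb =>
    obtain ⟨C, hC, h⟩ := ha
    obtain ⟨C', hC', h'⟩ := hb
    exact ⟨C * C', mul_nonneg hC hC', fun p => (p.1.mul_le' a b).trans
      (mul_le_mul (h p) (h' p) (apply_nonneg _ _) hC)⟩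
  | h4 a b ha hb =>
    obtain ⟨C, hC, h⟩ := ha
    obtain ⟨C', hC', h'⟩ := hb
    exact ⟨C + C', add_nonneg hC hC', fun p => (map_add_le_add _ a b).trans
      (add_le_add (h p) (h' p))⟩

/-- The largest C*-seminorm on the free unital star algebra that vanishes on the relators. -/
def seminorm : CStarSeminorm (Free n) := CStarSeminorm.largest P.relators P.bounded

/-- The universal unital C*-algebra with generators `u_{ij}` and the defining relations of the
braided free orthogonal quantum group: the completion in the largest C*-seminorm. -/
def Ao : Type := P.seminorm.Compl

instance : CStarAlgebra P.Ao := inferInstanceAs (CStarAlgebra P.seminorm.Compl)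

/-- The canonical homomorphism from the free algebra. -/
def toAo : Free n →⋆ₐ[ℂ] P.Ao := P.seminorm.toCompl

/-- The generators of the universal C*-algebra. -/
def u (i j : Fin n) : P.Ao := P.toAo (FreeStar.gen (i, j))

theorem u_relations : P.Relations P.u := by
  rw [relations_iff]
  intro r i j
  unfold u
  rw [← map_relator, ← norm_eq_zero]
  refine (P.seminorm.norm_toCompl _).trans ?_
  change (⨆ p : CStarSeminorm.Vanishing P.relators, p.1.toSeminorm _) = 0
  have : ∀ p : CStarSeminorm.Vanishing P.relators,
      p.1.toSeminorm (P.relator (fun k l => FreeStar.gen (k, l)) r i j) = 0 :=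
    fun p => p.2 _ ⟨r, i, j, rfl⟩
  simp only [this, ciSup_const]

/-- The universal property. -/
theorem exists_lift {D : Type*} [CStarAlgebra D] (v : Fin n → Fin n → D) (hv : P.Relations v) :
    ∃ φ : P.Ao →⋆ₐ[ℂ] D, ∀ i j, φ (P.u i j) = v i j := by
  let ev : Free n →⋆ₐ[ℂ] D := FreeStar.eval fun x => v x.1 x.2
  have hev : ∀ i j, ev (FreeStar.gen (i, j)) = v i j := fun i j => FreeStar.eval_gen _ _
  let p : CStarSeminorm.Vanishing P.relators := ⟨CStarSeminorm.ofHom ev, by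
    rintro _ ⟨r, i, j, rfl⟩
    change ‖ev _‖ = 0
    rw [map_relator, norm_eq_zero]
    simp only [hev]
    exact (P.relations_iff v).1 hv r i j⟩
  obtain ⟨Φ, hΦ⟩ := P.seminorm.exists_extension ev fun a => le_ciSup (P.bounded a) p
  exact ⟨Φ, fun i j => (hΦ _).trans (hev i j)⟩

theorem hom_ext {D : Type*} [CStarAlgebra D] {φ ψ : P.Ao →⋆ₐ[ℂ] D}
    (h : ∀ i j, φ (P.u i j) = ψ (P.u i j)) : φ = ψ := by
  have h1 : φ.comp P.toAo = ψ.comp P.toAo := FreeStar.hom_ext fun x => h x.1 x.2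
  have hφ : Continuous φ := AddMonoidHomClass.continuous_of_bound φ 1 fun a => by
    rw [one_mul]; exact NonUnitalStarAlgHom.norm_apply_le φ a
  have hψ : Continuous ψ := AddMonoidHomClass.continuous_of_bound ψ 1 fun a => by
    rw [one_mul]; exact NonUnitalStarAlgHom.norm_apply_le ψ a
  refine DFunLike.coe_injective ?_
  exact P.seminorm.denseRange_toCompl.equalizer hφ hψ
    (funext fun a => DFunLike.congr_fun h1 a)

theorem act_relations (w : Circle) :
    P.Relations fun i j => ((w ^ (P.deg j - P.deg i) : Circle) : ℂ) • P.u i j := by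
  have hw : ∀ k l : ℤ, star ((w ^ k : Circle) : ℂ) * ((w ^ l : Circle) : ℂ) =
      ((w ^ (l - k) : Circle) : ℂ) := by
    intro k l
    rw [Complex.star_def, ← Circle.coe_inv_eq_conj, ← Circle.coe_mul, ← zpow_neg, ← zpow_add]
    congr 2; ring
  have hs : ∀ k : ℤ, star ((w ^ k : Circle) : ℂ) = ((w ^ (-k) : Circle) : ℂ) := by
    intro k
    rw [Complex.star_def, ← Circle.coe_inv_eq_conj, ← zpow_neg]
  refine ⟨fun i j => ?_, fun i j => ?_, fun i j => ?_⟩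
  · have : ∀ k, star (((w ^ (P.deg i - P.deg k) : Circle) : ℂ) • P.u k i) *
        (((w ^ (P.deg j - P.deg k) : Circle) : ℂ) • P.u k j) =
        ((w ^ (P.deg j - P.deg i) : Circle) : ℂ) • (star (P.u k i) * P.u k j) := by
      intro k
      have e : P.deg j - P.deg k - (P.deg i - P.deg k) = P.deg j - P.deg i := by ring
      rw [star_smul, smul_mul_smul_comm, hw, e]
    simp only [this, ← Finset.smul_sum, P.u_relations.isometry]
    split_ifs with h
    · subst h; simp
    · simp
  · have : ∀ k, (((w ^ (P.deg k - P.deg i) : Circle) : ℂ) • P.u i k) *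
        star (((w ^ (P.deg k - P.deg j) : Circle) : ℂ) • P.u j k) =
        ((w ^ (P.deg j - P.deg i) : Circle) : ℂ) • (P.u i k * star (P.u j k)) := by
      intro k
      have e : P.deg k - P.deg i - (P.deg k - P.deg j) = P.deg j - P.deg i := by ring
      rw [star_smul, smul_mul_smul_comm, mul_comm, hw, e]
    simp only [this, ← Finset.smul_sum, P.u_relations.coisometry]
    split_ifs with h
    · subst h; simp
    · simp
  · have h1 : ∀ k, P.ω i k • (((w ^ (P.deg k - P.deg j) : Circle) : ℂ) • P.u j k) =
        ((w ^ (P.d - P.deg i - P.deg j) : Circle) : ℂ) • (P.ω i k • P.u j k) := by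
      intro k
      by_cases h : P.ω i k = 0
      · simp [h]
      · rw [smul_comm, ← P.homogeneous i k h]
        congr 4; ring
    have h2 : ∀ k, P.ω k j • star (((w ^ (P.deg i - P.deg k) : Circle) : ℂ) • P.u k i) =
        ((w ^ (P.d - P.deg i - P.deg j) : Circle) : ℂ) • (P.ω k j • star (P.u k i)) := by
      intro k
      by_cases h : P.ω k j = 0
      · simp [h]
      · rw [star_smul, hs, smul_comm, ← P.homogeneous k j h]
        congr 4; ring
    simp only [h1, h2, ← Finset.smul_sum]
    rw [smul_comm, P.u_relations.invariant, smul_comm]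

/-- The action of the circle group, determined by `β_w(u_{ij}) = w^{deg j - deg i} u_{ij}`. -/
def act (w : Circle) : P.Ao →⋆ₐ[ℂ] P.Ao := (P.exists_lift _ (P.act_relations w)).choose

theorem act_u (w : Circle) (i j : Fin n) :
    P.act w (P.u i j) = ((w ^ (P.deg j - P.deg i) : Circle) : ℂ) • P.u i j :=
  (P.exists_lift _ (P.act_relations w)).choose_spec i j

end Datum

/-! ### Braided tensor products -/

section BraidedTensor

variable {ι κ : Type*}

/-- The braiding unitary `ℓ²(ι) ⊗ ℓ²(κ) → ℓ²(κ) ⊗ ℓ²(ι)`,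
`δ_i ⊗ δ_k ↦ ζ^{q(i) p(k)} δ_k ⊗ δ_i`, for the `ℤ`-gradings `q` and `p` of the two bases. -/
def braiding (ζ : Circle) (q : ι → ℤ) (p : κ → ℤ) : L2 (ι × κ) ≃ₗᵢ[ℂ] L2 (κ × ι) :=
  phasePerm (Equiv.prodComm ι κ) fun x => ζ ^ (q x.1 * p x.2)

/-- The operator on `ℓ²(κ) ⊗ ℓ²(ι)` given by `T ⊗ 1` on `ℓ²(ι) ⊗ ℓ²(κ)`, conjugated by the
braiding unitary. -/
def braidedAmp (ζ : Circle) (p : κ → ℤ) (q : ι → ℤ) (T : Op ι) : Op (κ × ι) :=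
  conjOp (braiding ζ q p) (amp κ T)

/-- The braided tensor product `S ⊠_ζ T` of two star algebras of operators on the graded Hilbert
spaces `ℓ²(κ)` and `ℓ²(ι)`: the C*-algebra generated by the operators `a ⊗ 1` for `a ∈ S` and
the braided amplifications of `b ∈ T`. -/
def boxTimes (ζ : Circle) (p : κ → ℤ) (q : ι → ℤ)
    (S : StarSubalgebra ℂ (Op κ)) (T : StarSubalgebra ℂ (Op ι)) : StarSubalgebra ℂ (Op (κ × ι)) :=
  (StarAlgebra.adjoin ℂ (amp ι '' (S : Set (Op κ)) ∪
    braidedAmp ζ p q '' (T : Set (Op ι)))).topologicalClosure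

variable {ζ : Circle} {p : κ → ℤ} {q : ι → ℤ}
  {S : StarSubalgebra ℂ (Op κ)} {T : StarSubalgebra ℂ (Op ι)}

/-- The embedding of the first factor in a braided tensor product. -/
def inl (a : S) : boxTimes ζ p q S T :=
  ⟨amp ι a, StarSubalgebra.le_topologicalClosure _
    (StarAlgebra.subset_adjoin ℂ _ (Or.inl ⟨a, a.2, rfl⟩))⟩

/-- The embedding of the second factor in a braided tensor product. -/
def inr (b : T) : boxTimes ζ p q S T :=
  ⟨braidedAmp ζ p q b, StarSubalgebra.le_topologicalClosure _
    (StarAlgebra.subset_adjoin ℂ _ (Or.inr ⟨b, b.2, rfl⟩))⟩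

/-- The spatial tensor product of two star algebras of operators: for `ζ = 1` the braiding is the
flip, and the two embeddings are `a ↦ a ⊗ 1` and `b ↦ 1 ⊗ b`. -/
abbrev minTensor (S : StarSubalgebra ℂ (Op κ)) (T : StarSubalgebra ℂ (Op ι)) :
    StarSubalgebra ℂ (Op (κ × ι)) :=
  boxTimes 1 0 0 S T

/-- The elementary tensor `a ⊗ b`. -/
def tmul (a : S) (b : T) : minTensor S T := inl a * inr b

theorem braidedAmp_one_apply (T : Op ι) (f : L2 (κ × ι)) (k : κ) (i : ι) :
    braidedAmp 1 (0 : κ → ℤ) (0 : ι → ℤ) T f (k, i) =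
      T (slice (phasePerm (Equiv.prodComm κ ι) 1 f) k) i := by
  have h : (braiding 1 (0 : ι → ℤ) (0 : κ → ℤ)).symm f = phasePerm (Equiv.prodComm κ ι) 1 f := by
    ext x
    change ((_ : Circle) : ℂ) * _ = ((_ : Circle) : ℂ) * _
    simp
  change (((1 : Circle) ^ ((0 : ι → ℤ) i * (0 : κ → ℤ) k) : Circle) : ℂ) *
    amp κ T ((braiding 1 (0 : ι → ℤ) (0 : κ → ℤ)).symm f) (i, k) = _
  rw [h, one_zpow, Circle.coe_one, one_mul]
  rfl

end BraidedTensor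

/-! ### Bosonisation of braided quantum groups over the circle group -/

/-- Integer powers of a unitary element. -/
def uzpow {D : Type*} [Monoid D] [Star D] (z : D) : ℤ → D
  | Int.ofNat m => z ^ m
  | Int.negSucc m => star z ^ (m + 1)

/-- The bilateral shift `δ_k ↦ δ_{k+1}` on `ℓ²(ℤ)`. Identifying `L²(𝕋)` with `ℓ²(ℤ)` through the
orthonormal basis `(z^k)`, this is the operator of multiplication by the coordinate function
`z`. -/
def shift : Op ℤ := ((phasePerm (Equiv.addRight (1 : ℤ)) 1 : L2 ℤ ≃ₗᵢ[ℂ] L2 ℤ) : L2 ℤ →L[ℂ] L2 ℤ)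

/-- The C*-algebra `C(𝕋)`, generated by `z` and acting on `L²(𝕋)` by multiplication. -/
def circleAlg : StarSubalgebra ℂ (Op ℤ) := StarAlgebra.elemental ℂ shift

/-- The generator of `C(𝕋)`. -/
def circleGen : circleAlg := ⟨shift, StarAlgebra.elemental.self_mem ℂ shift⟩

/-- A faithful covariant representation of a C*-algebra `B` with an action `β` of the circle group,
on a Hilbert space with an orthonormal basis of homogeneous vectors, where the basis vector
`δ_m` has degree `deg m`. -/
structure CovariantRep {B : Type*} [CStarAlgebra B] (β : Circle → B →⋆ₐ[ℂ] B) where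
  ι : Type u
  deg : ι → ℤ
  ρ : B →⋆ₐ[ℂ] Op ι
  injective : Function.Injective ρ
  covariant : ∀ (w : Circle) (b : B),
    ρ (β w b) = conjOp (phasePerm (Equiv.refl ι) fun m => w ^ deg m) (ρ b)

namespace CovariantRep

variable {B : Type*} [CStarAlgebra B] {β : Circle → B →⋆ₐ[ℂ] B} (R : CovariantRep.{u} β)
  (ζ : Circle)

/-- The image of `B`. -/
def alg : StarSubalgebra ℂ (Op R.ι) := R.ρ.range

/-- The isomorphism onto the image. -/
def rep (b : B) : R.alg := ⟨R.ρ b, b, rfl⟩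

/-- The braided tensor product `B ⊠ B`. -/
def box : StarSubalgebra ℂ (Op (R.ι × R.ι)) := boxTimes ζ R.deg R.deg R.alg R.alg

/-- The braided tensor product `C(𝕋) ⊠ B`, the underlying C*-algebra of the bosonisation. -/
def bos : StarSubalgebra ℂ (Op (ℤ × R.ι)) := boxTimes ζ id R.deg circleAlg R.alg

/-- The braided tensor product `C(𝕋) ⊠ (B ⊠ B)`. -/
def bosBox : StarSubalgebra ℂ (Op (ℤ × (R.ι × R.ι))) :=
  boxTimes ζ id (fun x => R.deg x.1 + R.deg x.2) circleAlg (R.box ζ)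

/-- The embedding of the first factor in `B ⊠ B`. -/
def box₁ (b : B) : R.box ζ := inl (R.rep b)

/-- The embedding of the second factor in `B ⊠ B`. -/
def box₂ (b : B) : R.box ζ := inr (R.rep b)

/-- The embedding of the first factor in `C(𝕋) ⊠ B`. -/
def bos₁ (a : circleAlg) : R.bos ζ := inl a

/-- The embedding of the second factor in `C(𝕋) ⊠ B`. -/
def bos₂ (b : B) : R.bos ζ := inr (R.rep b)

/-- The embedding of the first factor in `C(𝕋) ⊠ (B ⊠ B)`. -/
def bosBox₁ (a : circleAlg) : R.bosBox ζ := inl a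

/-- The embedding of `B ⊠ B` in `C(𝕋) ⊠ (B ⊠ B)`. -/
def bosBox₂₃ (x : R.box ζ) : R.bosBox ζ := inr x

/-- The homomorphism `id ⊠ Δ : C(𝕋) ⊠ B → C(𝕋) ⊠ (B ⊠ B)`. -/
structure IsIdBox (Δ : B →⋆ₐ[ℂ] R.box ζ) (Θ : R.bos ζ →⋆ₐ[ℂ] R.bosBox ζ) : Prop where
  left : ∀ a : circleAlg, Θ (R.bos₁ ζ a) = R.bosBox₁ ζ a
  right : ∀ b : B, Θ (R.bos₂ ζ b) = R.bosBox₂₃ ζ (Δ b)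

/-- The homomorphism `ψ : C(𝕋) ⊠ B ⊠ B → (C(𝕋) ⊠ B) ⊗ (C(𝕋) ⊠ B)` with
`ψ(j₁(a)) = (j₁ ⊗ j₁)(Δ(a))`, where `Δ(z) = z ⊗ z` for the generator `z` of `C(𝕋)`, with
`ψ(j₂(b)) = (j₂ ⊗ j₁)(β(b))`, where `β(b) = b ⊗ z^k` if `b` is homogeneous of degree `k`,
and with `ψ(j₃(b)) = 1 ⊗ j₂(b)`. -/
structure IsSplitting (ψ : R.bosBox ζ →⋆ₐ[ℂ] minTensor (R.bos ζ) (R.bos ζ)) : Prop where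
  fst : ψ (R.bosBox₁ ζ circleGen) = tmul (R.bos₁ ζ circleGen) (R.bos₁ ζ circleGen)
  snd : ∀ (k : ℤ) (b : B), (∀ w : Circle, β w b = ((w ^ k : Circle) : ℂ) • b) →
    ψ (R.bosBox₂₃ ζ (R.box₁ ζ b)) = tmul (R.bos₂ ζ b) (uzpow (R.bos₁ ζ circleGen) k)
  trd : ∀ b : B, ψ (R.bosBox₂₃ ζ (R.box₂ ζ b)) = tmul 1 (R.bos₂ ζ b)

/-- The comultiplication of the bosonisation of a braided quantum group `(B, β, Δ)` is the
composite of `id ⊠ Δ` and `ψ`. -/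
def IsBosonisationComult (Δ : B →⋆ₐ[ℂ] R.box ζ)
    (ΔC : R.bos ζ →⋆ₐ[ℂ] minTensor (R.bos ζ) (R.bos ζ)) : Prop :=
  ∃ (Θ : R.bos ζ →⋆ₐ[ℂ] R.bosBox ζ) (ψ : R.bosBox ζ →⋆ₐ[ℂ] minTensor (R.bos ζ) (R.bos ζ)),
    R.IsIdBox ζ Δ Θ ∧ R.IsSplitting ζ ψ ∧ ΔC = ψ.comp Θ

end CovariantRep

namespace Datum

variable {n : ℕ} (P : Datum n)

/-- The comultiplication of the braided free orthogonal quantum group, with values in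
the braided tensor product. -/
def IsComult (R : CovariantRep.{u} P.act) (Δ : P.Ao →⋆ₐ[ℂ] R.box P.ζ) : Prop :=
  ∀ i k, Δ (P.u i k) = ∑ l, R.box₁ P.ζ (P.u i l) * R.box₂ P.ζ (P.u l k)

/-- The defining relations of the braided free orthogonal quantum group together with a unitary `z`
and its commutation relations with the generators. -/
structure BosRelations {D : Type*} [Ring D] [StarRing D] [Algebra ℂ D] (z : D)
    (u : Fin n → Fin n → D) : Prop where
  star_mul_self : star z * z = 1
  mul_star_self : z * star z = 1
  relations : P.Relations u
  commutation : ∀ i j, z * u i j = ((P.ζ ^ (P.deg i - P.deg j) : Circle) : ℂ) • (u i j * z)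

/-- The generator `z` of the bosonisation. -/
def bosZ (R : CovariantRep.{u} P.act) : R.bos P.ζ := R.bos₁ P.ζ circleGen

/-- The generators `u_{ij}` of the bosonisation. -/
def bosU (R : CovariantRep.{u} P.act) (i j : Fin n) : R.bos P.ζ := R.bos₂ P.ζ (P.u i j)

end Datum

end BraidedFree

end

open BraidedFree

noncomputable section

namespace BraidedFree

/-! ### Elementary tensors and operators on `ℓ²(κ × ι)` -/

section Operators

variable {ι κ : Type*}

/-! In `C` the unitary `z` and the copy of `B` multiply as in a crossed product by `ℤ`: the relation
between `z` and `u_ij` extends to `b z = z β_ζ(b)` for all `b` in `B`. Hence every star polynomial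
in the generators is a finite sum `∑ z^k b_k`, and the products of the two factors span a dense
subspace.

For the universal property, let `z`, `t_ij` in `D` satisfy the relations and let `φ : B → D` map
`u_ij` to `t_ij`. A polynomial with value `∑ z^k b_k` in `C` has the value `∑ z^k φ(b_k)` in `D`,
with the same `b_k`, so only the norm inequality `‖∑ z^k φ(b_k)‖ ≤ ‖∑ z^k b_k‖` is at stake. In `C`,
the sum maps `δ_0 ⊗ ξ` to a sum of orthogonal vectors `δ_k ⊗ b_k ξ`, so that `‖∑ b_k* b_k‖ ≤ ‖∑ z^k
b_k‖²` (`norm_sum_star_mul_le`). In `D`, the Cauchy–Schwarz inequality costs a factor `2N + 1` for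
degrees between `-N` and `N`. Replacing `x` by `(x* x)^(2^m)` makes `N` grow linearly in `2^m`, so
the factor disappears after taking roots (`norm_le_of_grading`). This gives `exists_bos_lift`.

The map `Δ` exists because the product of two solutions of the relations that commute up to the
braiding phases is again a solution (`Relations.mul`), and `id ⊠ Δ` comes from the universal
property of `C`. The map `ψ` is spatial: amplify by `ℓ²(ℤ)` and conjugate by a unitary (`splitHom`).
The required properties of `id ⊠ Δ` and `ψ` determine their composite on the generators of `C`,
which gives the formulas and uniqueness.

A faithful representation `ρ` of `B` comes from the GNS construction. It is made covariant by
passing to `u_ij ↦ z^(d_j - d_i) ⊗ ρ(u_ij)`, which is still faithful by the same norm estimate. -/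

theorem L2.summable_tensor (f : L2 κ) (g : L2 ι) :
    Summable fun x : κ × ι => ‖f x.1 * g x.2‖ ^ 2 := by
  have h := Summable.mul_of_nonneg (f := fun k => ‖f k‖ ^ 2) (g := fun i => ‖g i‖ ^ 2)
    (summable_sq f) (summable_sq g) (fun k => sq_nonneg ‖f k‖) fun i => sq_nonneg ‖g i‖
  simpa only [norm_mul, mul_pow] using h

/-- The elementary tensor `f ⊗ g`. -/
def tens (f : L2 κ) (g : L2 ι) : L2 (κ × ι) :=
  ⟨fun x => f x.1 * g x.2, memL2 (L2.summable_tensor f g)⟩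

theorem tens_apply (f : L2 κ) (g : L2 ι) (x : κ × ι) : tens f g x = f x.1 * g x.2 := rfl

theorem norm_tens (f : L2 κ) (g : L2 ι) : ‖tens f g‖ = ‖f‖ * ‖g‖ := by
  refine (sq_eq_sq₀ (norm_nonneg _) (by positivity)).1 ?_
  rw [mul_pow, norm_sq_eq, norm_sq_eq, norm_sq_eq,
    (summable_sq f).tsum_mul_tsum (summable_sq g)]
  · simp only [tens_apply, norm_mul, mul_pow]
  · simpa only [norm_mul, mul_pow] using L2.summable_tensor f g

theorem tens_smul_left (c : ℂ) (f : L2 κ) (g : L2 ι) : tens (c • f) g = c • tens f g := by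
  ext x
  simp only [tens_apply, lp.coeFn_smul, Pi.smul_apply, smul_eq_mul]
  ring

theorem tens_smul_right (c : ℂ) (f : L2 κ) (g : L2 ι) : tens f (c • g) = c • tens f g := by
  ext x
  simp only [tens_apply, lp.coeFn_smul, Pi.smul_apply, smul_eq_mul]
  ring

open scoped Classical in
theorem single_prod (k : κ) (i : ι) (c : ℂ) :
    (lp.single 2 (k, i) c : L2 (κ × ι)) = tens (lp.single 2 k c) (lp.single 2 i 1) := by
  ext ⟨k', i'⟩
  simp only [tens_apply, lp.single_apply, Pi.single_apply, Prod.mk.injEq]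
  split_ifs <;> simp_all

/-- Bounded operators that agree on elementary tensors are equal. -/
theorem ext_tens {H : Type*} [NormedAddCommGroup H] [NormedSpace ℂ H] {S T : L2 (κ × ι) →L[ℂ] H}
    (h : ∀ f g, S (tens f g) = T (tens f g)) : S = T := by
  classical
  refine lp.ext_continuousLinearMap (by norm_num) fun x => ?_
  ext
  change S (lp.single 2 x 1) = T (lp.single 2 x 1)
  rw [show x = (x.1, x.2) from rfl, single_prod, h]

/-- The slice `f(k, ·)` of a vector in `ℓ²(κ × ι)`. -/
def rslice (f : L2 (κ × ι)) (k : κ) : L2 ι :=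
  ⟨fun i => f (k, i), memL2 ((summable_sq f).comp_injective
    (i := fun i => (k, i)) fun _ _ h => (Prod.ext_iff.1 h).2)⟩

theorem rslice_apply (f : L2 (κ × ι)) (k : κ) (i : ι) : rslice f k i = f (k, i) := rfl

/-- Conjugation by a unitary, as a star homomorphism. -/
def conjHom (V : L2 ι ≃ₗᵢ[ℂ] L2 κ) : Op ι →⋆ₐ[ℂ] Op κ := V.conjStarAlgEquiv

theorem conjHom_apply (V : L2 ι ≃ₗᵢ[ℂ] L2 κ) (T : Op ι) : conjHom V T = conjOp V T := rfl

theorem conjOp_apply (V : L2 ι ≃ₗᵢ[ℂ] L2 κ) (T : Op ι) (f : L2 κ) :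
    conjOp V T f = V (T (V.symm f)) := rfl

theorem phasePerm_symm_apply (e : ι ≃ κ) (c : ι → Circle) (f : L2 κ) (i : ι) :
    (phasePerm e c).symm f i = (((c i)⁻¹ : Circle) : ℂ) * f (e i) := by
  change (((c (e.symm (e i)))⁻¹ : Circle) : ℂ) * f (e i) = _
  rw [Equiv.symm_apply_apply]

theorem amp_tens (T : Op ι) (f : L2 ι) (g : L2 κ) : amp κ T (tens f g) = tens (T f) g := by
  ext ⟨i, k⟩
  have : slice (tens f g) k = g k • f := by
    ext j
    simp only [slice_apply, tens_apply, lp.coeFn_smul, Pi.smul_apply, smul_eq_mul]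
    ring
  rw [amp_apply, this, map_smul, tens_apply, lp.coeFn_smul, Pi.smul_apply, smul_eq_mul, mul_comm]

/-- Since `T ⊗ 1` acts on every slice by `T`, this reduces the adjoint of an amplification to the
adjoint of `T`. -/
theorem inner_eq_tsum_slice (f g : L2 (ι × κ)) :
    inner ℂ f g = ∑' k, inner ℂ (slice f k) (slice g k) := by
  have h := ((Equiv.prodComm κ ι).summable_iff
    (f := fun x => inner ℂ (f x) (g x))).2 (lp.summable_inner f g)
  rw [lp.inner_eq_tsum, ← (Equiv.prodComm κ ι).tsum_eq]
  refine h.tsum_prod.trans (tsum_congr fun k => ?_)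
  rw [lp.inner_eq_tsum]
  rfl

variable (κ) in
/-- Amplification `T ↦ T ⊗ 1`, as a star homomorphism. -/
def ampHom : Op ι →⋆ₐ[ℂ] Op (ι × κ) where
  toFun := amp κ
  map_one' := ext_tens fun f g => by rw [amp_tens]; rfl
  map_mul' S T := ext_tens fun f g => by
    rw [mul_apply_eq_comp, amp_tens, amp_tens, amp_tens]; rfl
  map_zero' := by
    ext f x
    rw [amp_apply]
    rfl
  map_add' S T := by
    ext f x
    rw [amp_apply]
    rfl
  commutes' c := ext_tens fun f g => by
    rw [amp_tens]
    simp only [Algebra.algebraMap_eq_smul_one, smul_apply,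
      one_apply_eq_self, tens_smul_left]
  map_star' T := by
    rw [ContinuousLinearMap.star_eq_adjoint, ContinuousLinearMap.star_eq_adjoint,
      ContinuousLinearMap.eq_adjoint_iff]
    intro f g
    rw [inner_eq_tsum_slice, inner_eq_tsum_slice]
    refine tsum_congr fun k => ?_
    exact ContinuousLinearMap.adjoint_inner_left T (slice g k) (slice f k)

/-- The diagonal unitary operator `δ_i ↦ w^{q(i)} δ_i`. -/
def phase (q : ι → ℤ) (w : Circle) : L2 ι ≃ₗᵢ[ℂ] L2 ι :=
  phasePerm (Equiv.refl ι) fun i => w ^ q i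

theorem phase_apply (q : ι → ℤ) (w : Circle) (f : L2 ι) (i : ι) :
    phase q w f i = ((w ^ q i : Circle) : ℂ) * f i := rfl

theorem phase_symm (q : ι → ℤ) (w : Circle) : (phase q w).symm = phase q w⁻¹ := by
  ext f i
  rw [phase, phasePerm_symm_apply, phase_apply, inv_zpow]
  rfl

theorem phase_apply_inv (q : ι → ℤ) (w : Circle) (f : L2 ι) :
    phase q w (phase q w⁻¹ f) = f := by
  rw [← phase_symm, LinearIsometryEquiv.apply_symm_apply]

/-- Homogeneous operators of degree `k` on a graded Hilbert space. -/
def Homog (q : ι → ℤ) (k : ℤ) (b : Op ι) : Prop :=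
  ∀ w : Circle, conjOp (phase q w) b = ((w ^ k : Circle) : ℂ) • b

namespace Homog

variable {q : ι → ℤ} {k l : ℤ} {a b : Op ι}

theorem phase_comm (h : Homog q k b) (w : Circle) (f : L2 ι) :
    phase q w (b f) = ((w ^ k : Circle) : ℂ) • b (phase q w f) := by
  have := DFunLike.congr_fun (h w) (phase q w f)
  rwa [conjOp_apply, LinearIsometryEquiv.symm_apply_apply] at this

theorem of_phase_comm
    (h : ∀ w f, phase q w (b f) = ((w ^ k : Circle) : ℂ) • b (phase q w f)) : Homog q k b := by
  intro w
  ext1 f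
  rw [conjOp_apply, h, LinearIsometryEquiv.apply_symm_apply]
  rfl

theorem one : Homog q 0 1 := of_phase_comm fun w f => by simp

theorem mul (ha : Homog q k a) (hb : Homog q l b) : Homog q (k + l) (a * b) := by
  refine of_phase_comm fun w f => ?_
  rw [mul_apply_eq_comp, ha.phase_comm, hb.phase_comm, map_smul, smul_smul,
    ← Circle.coe_mul, ← zpow_add]
  rfl

theorem sum {α : Type*} {s : Finset α} {a : α → Op ι} (h : ∀ i ∈ s, Homog q k (a i)) :
    Homog q k (∑ i ∈ s, a i) := by
  intro w
  rw [← conjHom_apply, map_sum, Finset.smul_sum]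
  exact Finset.sum_congr rfl fun i hi => h i hi w

theorem star (h : Homog q k b) : Homog q (-k) (star b) := by
  intro w
  rw [← conjHom_apply, map_star, conjHom_apply, h w, star_smul]
  congr 1
  rw [Complex.star_def, ← Circle.coe_inv_eq_conj, ← zpow_neg]

-- The covariance of `b` multiplies this matrix entry by `w ^ q i` on one side and by `w ^ (q j +
-- k)` on the other; some `w` separates the two exponents.
open scoped Classical in
theorem matrixEntry_eq_zero (h : Homog q k b) (i j : ι) (hij : q j + k ≠ q i) :
    b (lp.single 2 j 1) i = 0 := by
  obtain ⟨w, hw⟩ : ∃ w : Circle, w ^ q i ≠ w ^ (q j + k) := by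
    have hm : q i - (q j + k) ≠ 0 := sub_ne_zero.2 hij.symm
    -- With `m` the difference of the exponents, this `w` satisfies `w ^ m = -1`.
    refine ⟨Circle.exp (Real.pi / ((q i - (q j + k) : ℤ) : ℝ)), fun hw => ?_⟩
    have h1 : Circle.exp (Real.pi / ((q i - (q j + k) : ℤ) : ℝ)) ^ (q i - (q j + k)) = 1 := by
      rw [zpow_sub, hw, mul_inv_cancel]
    rw [← Circle.exp_zsmul, zsmul_eq_mul, mul_div_cancel₀ _ (Int.cast_ne_zero.2 hm)] at h1
    have h2 := congrArg (fun z : Circle => (z : ℂ)) h1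
    simp only [Circle.coe_exp, Complex.exp_pi_mul_I, Circle.coe_one] at h2
    norm_num at h2
  have h1 : phase q w (lp.single 2 j 1) = ((w ^ q j : Circle) : ℂ) • lp.single 2 j (1 : ℂ) := by
    refine (phasePerm_single _ _ j).trans ?_
    rw [← lp.single_smul, smul_eq_mul, mul_one]
    rfl
  have h2 := congrArg (fun f : L2 ι => f i) (h.phase_comm w (lp.single 2 j 1))
  simp only [h1, phase_apply, map_smul, lp.coeFn_smul, Pi.smul_apply, smul_eq_mul,
    ← mul_assoc, ← Circle.coe_mul, ← zpow_add] at h2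
  by_contra h0
  exact hw (Circle.ext (by rw [mul_right_cancel₀ h0 h2, add_comm k]))

theorem apply_congr (h : Homog q k b) (i : ι) {f g : L2 ι}
    (hfg : ∀ j, q j + k = q i → f j = g j) : b f i = b g i := by
  classical
  rw [← sub_eq_zero]
  change (b f - b g) i = 0
  rw [← map_sub]
  have h1 := (lp.hasSum_single (p := 2) (by norm_num) (f - g)).mapL b
  have h2 := h1.mapL (lp.evalCLM ℂ (fun _ : ι => ℂ) 2 i)
  refine h2.unique ?_
  convert hasSum_zero with j
  change b (lp.single 2 j (f j - g j)) i = 0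
  by_cases hj : q j + k = q i
  · rw [hfg j hj, sub_self, lp.single_zero, map_zero]
    rfl
  · rw [show f j - g j = (f j - g j) • (1 : ℂ) by simp, lp.single_smul, map_smul, lp.coeFn_smul,
      Pi.smul_apply, h.matrixEntry_eq_zero i j hj, smul_zero]

end Homog

end Operators

/-! ### Braided amplifications and braided tensor products -/

section Braided

variable {ι κ : Type*} {ζ : Circle} {p : κ → ℤ} {q : ι → ℤ} {k l : ℤ} {a : Op κ} {b : Op ι}

theorem phase_tens (w : Circle) (f : L2 κ) (g : L2 ι) :
    phase (fun x : κ × ι => p x.1 + q x.2) w (tens f g) = tens (phase p w f) (phase q w g) := by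
  ext x
  simp only [phase_apply, tens_apply, zpow_add, Circle.coe_mul]
  ring

variable (ζ p q) in
/-- Braided amplification, as a star homomorphism. -/
def braidedHom : Op ι →⋆ₐ[ℂ] Op (κ × ι) := (conjHom (braiding ζ q p)).comp (ampHom κ)

/-- The braiding is diagonal in `j`: since `ζ^(q p) = (ζ^p)^q`, it acts on the slice over `j` as the
grading unitary at `ζ ^ p j`. No homogeneity of `b` is needed. -/
theorem braidedAmp_apply_phase (b : Op ι) (f : L2 (κ × ι)) (j : κ) (i : ι) :
    braidedAmp ζ p q b f (j, i) = conjOp (phase q (ζ ^ p j)) b (rslice f j) i := by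
  have h : slice ((braiding ζ q p).symm f) j = (phase q (ζ ^ p j)).symm (rslice f j) := by
    ext i
    rw [slice_apply, braiding, phasePerm_symm_apply, phase_symm, phase_apply]
    have h : (ζ ^ (q i * p j))⁻¹ = (ζ ^ p j)⁻¹ ^ q i := by rw [mul_comm, zpow_mul, inv_zpow]
    exact congrArg (fun c : Circle => (c : ℂ) * f (j, i)) h
  rw [conjOp_apply, ← h, phase_apply, ← zpow_mul, mul_comm (p j)]
  rfl

theorem Homog.braidedAmp_apply (hb : Homog q k b) (f : L2 (κ × ι)) (j : κ) (i : ι) :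
    braidedAmp ζ p q b f (j, i) = ((ζ ^ (k * p j) : Circle) : ℂ) * b (rslice f j) i := by
  rw [braidedAmp_apply_phase, hb, ← zpow_mul, mul_comm k]
  rfl

theorem braidedAmp_one_apply' (b : Op ι) (f : L2 (κ × ι)) (j : κ) (i : ι) :
    braidedAmp 1 p q b f (j, i) = b (rslice f j) i := by
  have h : ∀ f : L2 ι, phase q 1 f = f := fun f => by ext i; simp [phase_apply]
  rw [braidedAmp_apply_phase, conjOp_apply, one_zpow, phase_symm, inv_one, h, h]

theorem rslice_tens (f : L2 κ) (g : L2 ι) (j : κ) : rslice (tens f g) j = f j • g := rfl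

theorem Homog.braidedAmp_tens (hb : Homog q k b) (f : L2 κ) (g : L2 ι) :
    braidedAmp ζ p q b (tens f g) = tens (phase p (ζ ^ k) f) (b g) := by
  ext ⟨j, i⟩
  rw [hb.braidedAmp_apply, rslice_tens, map_smul, tens_apply, phase_apply, ← zpow_mul,
    lp.coeFn_smul, Pi.smul_apply, smul_eq_mul, mul_assoc]

/-- An operator of degree `k` in the second factor acts on the first one by the grading unitary at
`ζ^k`, which picks up `(ζ^k)^l` when it passes an operator of degree `l`. All braided commutation
relations come from here. -/
theorem Homog.braidedAmp_mul_amp (hb : Homog q k b) (ha : Homog p l a) :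
    braidedAmp ζ p q b * amp ι a =
      ((ζ ^ (k * l) : Circle) : ℂ) • (amp ι a * braidedAmp ζ p q b) := by
  refine ext_tens fun f g => ?_
  simp only [mul_apply_eq_comp, smul_apply]
  rw [amp_tens, hb.braidedAmp_tens, hb.braidedAmp_tens, amp_tens, ha.phase_comm, ← zpow_mul,
    tens_smul_left]

theorem Homog.amp (ha : Homog p l a) :
    Homog (fun x : κ × ι => p x.1 + q x.2) l (BraidedFree.amp ι a) := by
  intro w
  refine ext_tens fun f g => ?_
  rw [conjOp_apply, phase_symm, phase_tens, amp_tens, phase_tens, ha.phase_comm, phase_apply_inv,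
    phase_apply_inv, smul_apply, amp_tens, tens_smul_left]

theorem Homog.braidedAmp (hb : Homog q k b) :
    Homog (fun x : κ × ι => p x.1 + q x.2) k (BraidedFree.braidedAmp ζ p q b) := by
  intro w
  refine ext_tens fun f g => ?_
  have h : phase p w (phase p (ζ ^ k) (phase p w⁻¹ f)) = phase p (ζ ^ k) f := by
    ext j
    simp only [phase_apply, inv_zpow, Circle.coe_inv]
    field_simp
  rw [conjOp_apply, phase_symm, phase_tens, hb.braidedAmp_tens, phase_tens, hb.phase_comm,
    phase_apply_inv, h, smul_apply, hb.braidedAmp_tens, tens_smul_right]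

variable {S : StarSubalgebra ℂ (Op κ)} {T : StarSubalgebra ℂ (Op ι)}

/-- Braided tensor products are C*-algebras. -/
abbrev cstarAlgebraBoxTimes : CStarAlgebra (boxTimes ζ p q S T) :=
  StarSubalgebra.cstarAlgebra _ (h_closed := StarSubalgebra.isClosed_topologicalClosure _)

/-- The embedding of the first factor in a braided tensor product, as a star homomorphism. -/
def inlHom : S →⋆ₐ[ℂ] boxTimes ζ p q S T :=
  ((ampHom ι).comp S.subtype).codRestrict _ fun a => (inl a).2

/-- The embedding of the second factor in a braided tensor product, as a star homomorphism. -/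
def inrHom : T →⋆ₐ[ℂ] boxTimes ζ p q S T :=
  ((braidedHom ζ p q).comp T.subtype).codRestrict _ fun b => (inr b).2

theorem inr_mul_inl {a : S} {b : T} (hb : Homog q k (b : Op ι)) (ha : Homog p l (a : Op κ)) :
    (inr b * inl a : boxTimes ζ p q S T) = ((ζ ^ (k * l) : Circle) : ℂ) • (inl a * inr b) :=
  Subtype.ext (hb.braidedAmp_mul_amp ha)

/-- A closed star algebra of operators that contains the generators of a braided tensor product
contains the braided tensor product. -/
theorem boxTimes_le {A : StarSubalgebra ℂ (Op (κ × ι))} (hA : IsClosed (A : Set (Op (κ × ι))))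
    (h1 : ∀ a ∈ S, amp ι a ∈ A) (h2 : ∀ b ∈ T, braidedAmp ζ p q b ∈ A) :
    boxTimes ζ p q S T ≤ A := by
  refine StarSubalgebra.topologicalClosure_minimal (StarAlgebra.adjoin_le ?_) hA
  rintro _ (⟨a, ha, rfl⟩ | ⟨b, hb, rfl⟩)
  exacts [h1 a ha, h2 b hb]

end Braided

/-! ### Continuity of star homomorphisms, and the bilateral shift -/

theorem continuous_starAlgHom {A B : Type*} [CStarAlgebra A] [CStarAlgebra B] (φ : A →⋆ₐ[ℂ] B) :
    Continuous φ :=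
  AddMonoidHomClass.continuous_of_bound φ 1 fun a => by
    rw [one_mul]; exact NonUnitalStarAlgHom.norm_apply_le φ a

theorem isClosed_comap {A B : Type*} [CStarAlgebra A] [CStarAlgebra B] (φ : A →⋆ₐ[ℂ] B)
    {S : StarSubalgebra ℂ B} (hS : IsClosed (S : Set B)) :
    IsClosed (S.comap φ : Set A) :=
  hS.preimage (continuous_starAlgHom φ)

theorem circleAlg_le {A : StarSubalgebra ℂ (Op ℤ)} (hA : IsClosed (A : Set (Op ℤ)))
    (h : shift ∈ A) : circleAlg ≤ A :=
  StarAlgebra.elemental.le_of_mem hA h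

theorem shift_apply (f : L2 ℤ) (m : ℤ) : shift f m = f (m - 1) := by
  change ((1 : Circle) : ℂ) * f (m + -1) = _
  rw [Circle.coe_one, one_mul, sub_eq_add_neg]

theorem homog_shift : Homog id 1 shift := by
  refine Homog.of_phase_comm fun w f => ?_
  ext m
  rw [phase_apply, shift_apply, lp.coeFn_smul, Pi.smul_apply, shift_apply, phase_apply, smul_eq_mul,
    ← mul_assoc, ← Circle.coe_mul, ← zpow_add]
  simp

theorem star_shift_mul_shift : star shift * shift = 1 := by
  rw [ContinuousLinearMap.star_eq_adjoint]
  exact ContinuousLinearMap.inner_map_map_iff_adjoint_comp_self shift |>.1 fun f g =>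
    LinearIsometryEquiv.inner_map_map _ f g

theorem star_shift_apply (f : L2 ℤ) (m : ℤ) : star shift f m = f (m + 1) := by
  obtain ⟨g, rfl⟩ : ∃ g, shift g = f := ⟨_, LinearIsometryEquiv.apply_symm_apply _ f⟩
  have h : star shift (shift g) = g := DFunLike.congr_fun star_shift_mul_shift g
  rw [h, shift_apply, add_sub_cancel_right]

theorem shift_mul_star_shift : shift * star shift = 1 := by
  ext f m
  rw [mul_apply_eq_comp, shift_apply, star_shift_apply, sub_add_cancel]
  rfl

/-! ### Norm estimates -/

/-- The Cauchy–Schwarz inequality for finite families in a C*-algebra. -/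
theorem norm_sum_sq_le {D α : Type*} [CStarAlgebra D] (s : Finset α) (c : α → D) :
    ‖∑ k ∈ s, c k‖ ^ 2 ≤ s.card * ‖∑ k ∈ s, star (c k) * c k‖ := by
  let _ := CStarAlgebra.spectralOrder D
  have _ := CStarAlgebra.spectralOrderedRing D
  set S := ∑ k ∈ s, c k with hS
  set Q := ∑ k ∈ s, star (c k) * c k with hQ
  -- The sum of the positive elements `|c_k - c_l|²` over all pairs is `2 |s| Q - 2 S* S`.
  have h1 : ∑ k ∈ s, ∑ l ∈ s, star (c k - c l) * (c k - c l) =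
      (2 : ℝ) • ((s.card : ℝ) • Q) - (2 : ℝ) • (star S * S) := by
    simp only [star_sub, sub_mul, mul_sub, Finset.sum_sub_distrib, Finset.sum_const,
      ← Finset.mul_sum, ← Finset.sum_mul, ← Finset.smul_sum, ← star_sum, ← hS, ← hQ,
      two_smul, Nat.cast_smul_eq_nsmul]
    abel
  have h2 : (2 : ℝ) • (star S * S) ≤ (2 : ℝ) • ((s.card : ℝ) • Q) := by
    rw [← sub_nonneg, ← h1]
    exact Finset.sum_nonneg fun k _ => Finset.sum_nonneg fun l _ => star_mul_self_nonneg _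
  have h3 := CStarAlgebra.norm_le_norm_of_nonneg_of_le
    (smul_nonneg zero_le_two (star_mul_self_nonneg S)) h2
  rw [norm_smul, norm_smul, norm_smul, CStarRing.norm_star_mul_self] at h3
  simp only [Real.norm_eq_abs, Nat.abs_cast, Nat.abs_ofNat] at h3
  linarith

/-- If `a > b > 0`, then `(a / b) ^ N` would grow exponentially along `N = 2 ^ m`, while it is
bounded by `C N + 1`. -/
theorem le_of_pow_two_pow_le {a b C : ℝ} (hb : 0 ≤ b)
    (h : ∀ m : ℕ, a ^ 2 ^ m ≤ (C * 2 ^ m + 1) * b ^ 2 ^ m) : a ≤ b := by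
  by_contra! hab
  have ha' : 0 < a := hb.trans_lt hab
  rcases hb.eq_or_lt with rfl | hb
  · have := h 0
    simp at this
    exact absurd this (not_le.2 ha')
  · have hr : 1 < a / b := (one_lt_div hb).2 hab
    have h1 := ((tendsto_pow_const_div_const_pow_of_one_lt 1 hr).const_mul C).add
      (tendsto_pow_const_div_const_pow_of_one_lt 0 hr)
    have h2 := h1.comp (tendsto_pow_atTop_atTop_of_one_lt one_lt_two)
    rw [mul_zero, add_zero] at h2
    obtain ⟨m, hm⟩ := (h2.eventually (gt_mem_nhds one_pos)).exists
    simp only [Function.comp, pow_one, pow_zero, Nat.cast_pow, Nat.cast_ofNat] at hm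
    have h3 : 0 < (a / b) ^ 2 ^ m := by positivity
    rw [← mul_div_assoc, ← add_div, div_lt_one h3, div_pow, lt_div_iff₀ (by positivity)] at hm
    exact absurd (h m) (not_le.2 hm)

/-! ### Graded star algebras and the comparison of norms -/

section Grading

variable {F : Type*} [Ring F] [Algebra ℂ F]

/-- The span of the subspaces of degree at most `M` in absolute value. -/
def window (H : ℤ → Submodule ℂ F) (M : ℕ) : Submodule ℂ F :=
  ⨆ k ∈ Finset.Icc (-M : ℤ) M, H k

variable {H : ℤ → Submodule ℂ F}

theorem le_window {k : ℤ} {M : ℕ} (h : k.natAbs ≤ M) : H k ≤ window H M :=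
  le_iSup₂_of_le k (Finset.mem_Icc.2 (by omega)) le_rfl

theorem window_mono {M N : ℕ} (h : M ≤ N) : window H M ≤ window H N :=
  iSup₂_le fun k hk => le_window (by have := Finset.mem_Icc.1 hk; omega)

theorem window_mul (hmul : ∀ k l x y, x ∈ H k → y ∈ H l → x * y ∈ H (k + l)) {M N : ℕ} :
    window H M * window H N ≤ window H (M + N) := by
  refine Submodule.mul_le.2 fun x hx y hy => ?_
  obtain ⟨μ, rfl⟩ := (Submodule.mem_iSup_finset_iff_exists_sum _ _).1 hx
  obtain ⟨ν, rfl⟩ := (Submodule.mem_iSup_finset_iff_exists_sum _ _).1 hy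
  rw [Finset.sum_mul_sum]
  refine Submodule.sum_mem _ fun k hk => Submodule.sum_mem _ fun l hl =>
    le_window ?_ (hmul k l _ _ (μ k).2 (ν l).2)
  have := Finset.mem_Icc.1 hk
  have := Finset.mem_Icc.1 hl
  omega

theorem window_star [StarRing F] [StarModule ℂ F] (hstar : ∀ k x, x ∈ H k → star x ∈ H (-k))
    {M : ℕ} {x : F} (hx : x ∈ window H M) : star x ∈ window H M := by
  obtain ⟨μ, rfl⟩ := (Submodule.mem_iSup_finset_iff_exists_sum _ _).1 hx
  rw [star_sum]
  refine Submodule.sum_mem _ fun k hk => le_window ?_ (hstar k _ (μ k).2)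
  have := Finset.mem_Icc.1 hk
  omega

theorem window_pow (hmul : ∀ k l x y, x ∈ H k → y ∈ H l → x * y ∈ H (k + l)) (hone : 1 ∈ H 0)
    {M : ℕ} {x : F} (hx : x ∈ window H M) (N : ℕ) : x ^ N ∈ window H (M * N) := by
  induction N with
  | zero => rw [pow_zero]; exact le_window (by simp) hone
  | succ N ih =>
    rw [pow_succ]
    exact window_mul hmul (Submodule.mul_mem_mul ih hx)

/-- Norms of self-adjoint elements are multiplicative on powers `2 ^ m`, so passing to `(x*
x)^(2^m)` loses nothing on either side of the comparison. -/
theorem norm_map_star_mul_self_pow [StarRing F] {A : Type*} [CStarAlgebra A] (χ : F →⋆ₐ[ℂ] A)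
    (x : F) (m : ℕ) : ‖χ ((star x * x) ^ 2 ^ m)‖ ^ 2 = ((‖χ x‖ ^ 2) ^ 2) ^ 2 ^ m := by
  have h := (IsSelfAdjoint.star_mul_self (χ x)).norm_pow_two_pow m
  rw [map_pow, map_mul, map_star, h, CStarRing.norm_star_mul_self, ← sq]
  ring

/-- Let `φ` and `ψ` be star homomorphisms on a star algebra with a grading such that `ψ` dominates
the Hilbert module norm `‖∑ φ(x_k)* φ(x_k)‖` for the homogeneous components `x_k`. Then `ψ`
dominates `φ`. -/
theorem norm_le_of_grading [StarRing F] [StarModule ℂ F] {D E : Type*} [CStarAlgebra D]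
    [CStarAlgebra E] (φ : F →⋆ₐ[ℂ] D) (ψ : F →⋆ₐ[ℂ] E)
    (hmul : ∀ k l x y, x ∈ H k → y ∈ H l → x * y ∈ H (k + l)) (hone : 1 ∈ H 0)
    (hstar : ∀ k x, x ∈ H k → star x ∈ H (-k))
    (hkey : ∀ (s : Finset ℤ) (x : ∀ k, H k),
      ‖∑ k ∈ s, star (φ (x k)) * φ (x k)‖ ≤ ‖ψ (∑ k ∈ s, (x k : F))‖ ^ 2)
    {M : ℕ} {x : F} (hx : x ∈ window H M) : ‖φ x‖ ≤ ‖ψ x‖ := by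
  -- Cauchy–Schwarz over the `2N + 1` degrees of the window, followed by `hkey`.
  have h1 : ∀ N y, y ∈ window H N → ‖φ y‖ ^ 2 ≤ (2 * N + 1) * ‖ψ y‖ ^ 2 := by
    intro N y hy
    obtain ⟨μ, rfl⟩ := (Submodule.mem_iSup_finset_iff_exists_sum _ _).1 hy
    rw [map_sum]
    refine (norm_sum_sq_le _ _).trans ?_
    have hc : ((Finset.Icc (-N : ℤ) N).card : ℝ) = 2 * N + 1 := by
      rw [Int.card_Icc, show ((N : ℤ) + 1 - -N).toNat = 2 * N + 1 by omega]
      push_cast; ring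
    rw [hc]
    exact mul_le_mul_of_nonneg_left (hkey _ μ) (by positivity)
  have h3 : (‖φ x‖ ^ 2) ^ 2 ≤ (‖ψ x‖ ^ 2) ^ 2 := by
    -- The element `(x* x)^(2^m)` lies in the window of size `(M + M) 2^m`, so the Cauchy–Schwarz
    -- factor is `2 (M + M) 2^m + 1`.
    refine le_of_pow_two_pow_le (C := 2 * (M + M)) (by positivity) fun m => ?_
    have h := h1 _ _ (window_pow hmul hone
      (window_mul hmul (Submodule.mul_mem_mul (window_star hstar hx) hx)) (2 ^ m))
    rw [norm_map_star_mul_self_pow, norm_map_star_mul_self_pow] at h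
    refine h.trans (le_of_eq ?_)
    push_cast
    ring
  rwa [sq_le_sq₀ (by positivity) (by positivity),
    sq_le_sq₀ (by positivity) (by positivity)] at h3

theorem exists_mem_window {X : Type*} {H : ℤ → Submodule ℂ (FreeStar X)}
    (hmul : ∀ k l x y, x ∈ H k → y ∈ H l → x * y ∈ H (k + l)) (hone : 1 ∈ H 0)
    (hstar : ∀ k x, x ∈ H k → star x ∈ H (-k)) (hgen : ∀ i, ∃ k, FreeStar.gen i ∈ H k)
    (x : FreeStar X) : ∃ M, x ∈ window H M := by
  induction x using FreeStar.induct with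
  | h1 c =>
    refine ⟨0, le_window (k := 0) le_rfl ?_⟩
    rw [Algebra.algebraMap_eq_smul_one]
    exact Submodule.smul_mem _ _ hone
  | h2 x =>
    rcases x with i | i
    · obtain ⟨k, hk⟩ := hgen i
      exact ⟨_, le_window le_rfl hk⟩
    · obtain ⟨k, hk⟩ := hgen i
      refine ⟨_, le_window (k := -k) le_rfl ?_⟩
      rw [show (FreeStar.letter (Sum.inr i) : FreeStar X) = star (FreeStar.gen i) from
        (FreeStar.star_letter (Sum.inl i)).symm]
      exact hstar k _ hk
  | h3 a b ha hb =>
    obtain ⟨M, ha⟩ := ha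
    obtain ⟨N, hb⟩ := hb
    exact ⟨_, window_mul hmul (Submodule.mul_mem_mul ha hb)⟩
  | h4 a b ha hb =>
    obtain ⟨M, ha⟩ := ha
    obtain ⟨N, hb⟩ := hb
    exact ⟨max M N, Submodule.add_mem _ (window_mono (le_max_left _ _) ha)
      (window_mono (le_max_right _ _) hb)⟩

end Grading

/-! ### Integer powers of unitaries -/

section Uzpow

variable {D E : Type*} [Ring D] [StarRing D] [Ring E] [StarRing E]

theorem map_uzpow [Algebra ℂ D] [Algebra ℂ E] (φ : D →⋆ₐ[ℂ] E) (z : D) (k : ℤ) :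
    φ (uzpow z k) = uzpow (φ z) k := by
  cases k with
  | ofNat m => exact map_pow φ z m
  | negSucc m => exact (map_pow φ (star z) (m + 1)).trans (by rw [map_star]; rfl)

/-- Inverses in the unitary group are adjoints; the laws of exponents for `uzpow` are inherited from
that group. -/
theorem uzpow_coe_unitary (z : unitary D) (k : ℤ) :
    uzpow (z : D) k = ((z ^ k : unitary D) : D) := by
  cases k with
  | ofNat m => simp [uzpow]
  | negSucc m =>
    rw [zpow_negSucc, ← inv_pow, SubmonoidClass.coe_pow]
    rfl

variable {z : D} (h1 : star z * z = 1) (h2 : z * star z = 1)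
include h1 h2

theorem uzpow_add (k l : ℤ) : uzpow z (k + l) = uzpow z k * uzpow z l := by
  have := uzpow_coe_unitary (⟨z, Unitary.mem_iff.2 ⟨h1, h2⟩⟩ : unitary D)
  simp only at this
  rw [this, this, this, zpow_add, Submonoid.coe_mul]

theorem star_uzpow (k : ℤ) : star (uzpow z k) = uzpow z (-k) := by
  have := uzpow_coe_unitary (⟨z, Unitary.mem_iff.2 ⟨h1, h2⟩⟩ : unitary D)
  simp only at this
  rw [this, this, zpow_neg]
  rfl

theorem star_uzpow_mul_uzpow (k : ℤ) : star (uzpow z k) * uzpow z k = 1 := by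
  rw [star_uzpow h1 h2, ← uzpow_add h1 h2, neg_add_cancel]
  exact pow_zero z

end Uzpow

/-! ### The lower bound for norms in `C(𝕋) ⊠ B` -/

section KeyEstimate

variable {ι κ : Type*}

theorem uzpow_shift_apply (k : ℤ) (f : L2 ℤ) (m : ℤ) : uzpow shift k f m = f (m - k) := by
  have hs := uzpow_add star_shift_mul_shift shift_mul_star_shift
  induction k using Int.induction_on generalizing m with
  | zero => rw [sub_zero]; rfl
  | succ k ih =>
    rw [add_comm, hs, mul_apply_eq_comp, show uzpow shift 1 = shift from pow_one _, shift_apply, ih]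
    exact congrArg f (by ring)
  | pred k ih =>
    rw [sub_eq_add_neg, add_comm, hs, mul_apply_eq_comp,
      show uzpow shift (-1) = star shift from pow_one _, star_shift_apply, ih]
    exact congrArg f (by ring)

theorem summable_rslice_and_tsum (f : L2 (κ × ι)) :
    (Summable fun k => ‖rslice f k‖ ^ 2) ∧ ∑' k, ‖rslice f k‖ ^ 2 = ‖f‖ ^ 2 := by
  have h := summable_sq f
  simp only [norm_sq_eq]
  exact ⟨h.prod, h.tsum_prod.symm⟩

/-- The hypothesis compares the quadratic forms of the positive operator `∑ b_k* b_k` and of the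
scalar `r`. -/
theorem norm_sum_star_mul_le_of_forall {α : Type*} {s : Finset α} {b : α → Op ι} {r : ℝ}
    (hr : 0 ≤ r) (h : ∀ ξ : L2 ι, ∑ k ∈ s, ‖b k ξ‖ ^ 2 ≤ r * ‖ξ‖ ^ 2) :
    ‖∑ k ∈ s, star (b k) * b k‖ ≤ r := by
  refine (CStarAlgebra.norm_le_iff_le_algebraMap _ hr
    (Finset.sum_nonneg fun k _ => star_mul_self_nonneg (b k))).2 ?_
  change _ ≤ algebraMap ℂ (Op ι) (algebraMap ℝ ℂ r)
  rw [ContinuousLinearMap.le_def, ContinuousLinearMap.isPositive_iff_complex]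
  intro ξ
  have h1 : inner ℂ ((algebraMap ℂ (Op ι) (algebraMap ℝ ℂ r) - ∑ k ∈ s, star (b k) * b k) ξ) ξ =
      ((r * ‖ξ‖ ^ 2 - ∑ k ∈ s, ‖b k ξ‖ ^ 2 : ℝ) : ℂ) := by
    have h2 : ∀ k, inner ℂ ((star (b k) * b k) ξ) ξ = ((‖b k ξ‖ ^ 2 : ℝ) : ℂ) := fun k => by
      rw [mul_apply_eq_comp, ContinuousLinearMap.star_eq_adjoint,
        ContinuousLinearMap.adjoint_inner_left, inner_self_eq_norm_sq_to_K]
      push_cast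
      rfl
    have h3 : inner ℂ (algebraMap ℂ (Op ι) (algebraMap ℝ ℂ r) ξ) ξ = ((r * ‖ξ‖ ^ 2 : ℝ) : ℂ) := by
      rw [Algebra.algebraMap_eq_smul_one, smul_apply, one_apply_eq_self,
        inner_smul_left, inner_self_eq_norm_sq_to_K]
      simp
    rw [sub_apply, inner_sub_left, h3, sum_apply, sum_inner]
    simp only [h2]
    push_cast
    rfl
  rw [h1]
  exact ⟨congrArg Complex.ofReal (Complex.ofReal_re _),
    (sub_nonneg.2 (h ξ)).trans_eq (Complex.ofReal_re _).symm⟩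

variable {ζ : Circle} {q : ι → ℤ}

/-- The operators `Z^k b_k` map a vector `δ_0 ⊗ ξ` to the orthogonal vectors `δ_k ⊗ b_k ξ`. -/
theorem norm_sum_star_mul_le (s : Finset ℤ) (b : ℤ → Op ι) :
    ‖∑ k ∈ s, star (b k) * b k‖ ≤
      ‖∑ k ∈ s, amp ι (uzpow shift k) * braidedAmp ζ id q (b k)‖ ^ 2 := by
  refine norm_sum_star_mul_le_of_forall (sq_nonneg _) fun ξ => ?_
  set T := ∑ k ∈ s, amp ι (uzpow shift k) * braidedAmp ζ id q (b k) with hT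
  let δ : L2 ℤ := lp.single 2 0 1
  have h1 : ∀ c : Op ι, braidedAmp ζ id q c (tens δ ξ) = tens δ (c ξ) := by
    intro c
    ext ⟨j, i⟩
    have h1 : ∀ f : L2 ι, phase q 1 f = f := fun f => by ext i; simp [phase_apply]
    rw [braidedAmp_apply_phase, rslice_tens, tens_apply]
    -- Only the coordinate `j = 0` of `δ` is nonzero, and there the braiding phase is trivial; hence
    -- `c` need not be homogeneous.
    by_cases hj : j = 0
    · subst hj
      rw [show δ 0 = 1 from lp.single_apply_self _ _ _, id, zpow_zero, conjOp_apply, phase_symm,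
        inv_one, h1, h1, one_smul, one_mul]
    · rw [show δ j = 0 from lp.single_apply_ne _ _ _ hj, zero_smul, map_zero, zero_mul]
      rfl
  have h2 : ∀ k ∈ s, rslice (T (tens δ ξ)) k = b k ξ := by
    intro k hk
    ext i
    have : ∀ l, (amp ι (uzpow shift l) * braidedAmp ζ id q (b l)) (tens δ ξ) (k, i) =
        if k = l then b l ξ i else 0 := by
      intro l
      rw [mul_apply_eq_comp, h1, amp_tens, tens_apply, uzpow_shift_apply]
      split_ifs with hkl
      · subst hkl
        rw [sub_self, show δ 0 = 1 from lp.single_apply_self _ _ _, one_mul]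
      · rw [show δ (k - l) = 0 from lp.single_apply_ne _ _ _ (sub_ne_zero.2 hkl), zero_mul]
    rw [rslice_apply, hT, sum_apply, lp.coeFn_sum, Finset.sum_apply]
    simp only [this]
    rw [Finset.sum_ite_eq, if_pos hk]
  have hδ : ‖tens δ ξ‖ = ‖ξ‖ := by
    rw [norm_tens, show ‖δ‖ = 1 from (lp.norm_single (by norm_num) _ _).trans norm_one, one_mul]
  calc ∑ k ∈ s, ‖b k ξ‖ ^ 2 = ∑ k ∈ s, ‖rslice (T (tens δ ξ)) k‖ ^ 2 :=
        Finset.sum_congr rfl fun k hk => by rw [h2 k hk]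
    _ ≤ ‖T (tens δ ξ)‖ ^ 2 := by
        rw [← (summable_rslice_and_tsum _).2]
        exact (summable_rslice_and_tsum _).1.sum_le_tsum _ fun _ _ => sq_nonneg _
    _ ≤ ‖T‖ ^ 2 * ‖ξ‖ ^ 2 := by
        rw [← mul_pow, ← hδ]
        exact pow_le_pow_left₀ (norm_nonneg _) (T.le_opNorm _) 2

end KeyEstimate

/-! ### The universal property of the bosonisation -/

/-- `C(𝕋)` is a C*-algebra. -/
abbrev cstarAlgebraCircleAlg : CStarAlgebra circleAlg :=
  StarSubalgebra.cstarAlgebra _ (h_closed := StarAlgebra.elemental.isClosed ℂ shift)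

attribute [local instance] cstarAlgebraBoxTimes cstarAlgebraCircleAlg

theorem circleAlg_hom_ext {D : Type*} [CStarAlgebra D] {φ ψ : circleAlg →⋆ₐ[ℂ] D}
    (h : φ circleGen = ψ circleGen) : φ = ψ :=
  StarAlgebra.elemental.starAlgHomClass_ext ℂ (continuous_starAlgHom φ) (continuous_starAlgHom ψ) h

/-- A star homomorphism that is dominated by another one with dense range factors through it. -/
theorem exists_factor {F D E : Type*} [Ring F] [StarRing F] [Algebra ℂ F] [StarModule ℂ F]
    [CStarAlgebra D] [CStarAlgebra E] (φ : F →⋆ₐ[ℂ] D) (ψ : F →⋆ₐ[ℂ] E) (hψ : DenseRange ψ)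
    (h : ∀ x, ‖φ x‖ ≤ ‖ψ x‖) : ∃ Φ : E →⋆ₐ[ℂ] D, ∀ x, Φ (ψ x) = φ x := by
  -- The completion of `F` in the seminorm `‖ψ(·)‖` is a copy of `E`: the extension `Ψ` of `ψ` is
  -- isometric, so its range is closed, and it is dense.
  let p := CStarSeminorm.ofHom ψ
  obtain ⟨Φ, hΦ⟩ := p.exists_extension φ h
  obtain ⟨Ψ, hΨ⟩ := p.exists_extension ψ fun _ => le_rfl
  have hn : ∀ x, ‖Ψ x‖ = ‖x‖ := by
    intro x
    refine p.denseRange_toCompl.induction_on (p := fun x => ‖Ψ x‖ = ‖x‖) x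
      (isClosed_eq (continuous_starAlgHom Ψ).norm continuous_norm) fun a => ?_
    rw [hΨ, p.norm_toCompl]
    rfl
  have hi : Isometry Ψ := AddMonoidHomClass.isometry_of_norm Ψ hn
  have hs : Function.Surjective Ψ := by
    have h1 : IsClosed (Set.range Ψ) := hi.isClosedEmbedding.isClosed_range
    have h2 : Dense (Set.range Ψ) := hψ.mono (by rintro _ ⟨a, rfl⟩; exact ⟨_, hΨ a⟩)
    exact Set.range_eq_univ.1 (h1.closure_eq ▸ h2.closure_eq)
  let e : p.Compl ≃⋆ₐ[ℂ] E := StarAlgEquiv.ofBijective Ψ ⟨hi.injective, hs⟩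
  refine ⟨Φ.comp (e.symm : E →⋆ₐ[ℂ] p.Compl), fun x => ?_⟩
  have : e.symm (ψ x) = p.toCompl x := by
    rw [← hΨ]
    exact e.symm_apply_apply _
  exact (congrArg Φ this).trans (hΦ x)

variable {B : Type*} [CStarAlgebra B] {β : Circle → B →⋆ₐ[ℂ] B} (R : CovariantRep.{u} β)
  (ζ : Circle)

namespace CovariantRep

/-- `B ⊠ B` is a C*-algebra. -/
abbrev cstarAlgebraBox : CStarAlgebra (R.box ζ) :=
  inferInstanceAs (CStarAlgebra (boxTimes _ _ _ _ _))

/-- `C(𝕋) ⊠ B` is a C*-algebra. -/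
abbrev cstarAlgebraBos : CStarAlgebra (R.bos ζ) :=
  inferInstanceAs (CStarAlgebra (boxTimes _ _ _ _ _))

/-- `C(𝕋) ⊠ (B ⊠ B)` is a C*-algebra. -/
abbrev cstarAlgebraBosBox : CStarAlgebra (R.bosBox ζ) :=
  inferInstanceAs (CStarAlgebra (boxTimes _ _ _ _ _))

/-- The isomorphism onto the image, as a star homomorphism. -/
def repHom : B →⋆ₐ[ℂ] R.alg := R.ρ.rangeRestrict

/-- The embedding of the first factor in `B ⊠ B`, as a star homomorphism. -/
def box₁Hom : B →⋆ₐ[ℂ] R.box ζ := inlHom.comp R.repHom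

/-- The embedding of the second factor in `B ⊠ B`, as a star homomorphism. -/
def box₂Hom : B →⋆ₐ[ℂ] R.box ζ := inrHom.comp R.repHom

/-- The embedding of the first factor in `C(𝕋) ⊠ B`, as a star homomorphism. -/
def bos₁Hom : circleAlg →⋆ₐ[ℂ] R.bos ζ := inlHom

/-- The embedding of the second factor in `C(𝕋) ⊠ B`, as a star homomorphism. -/
def bos₂Hom : B →⋆ₐ[ℂ] R.bos ζ := inrHom.comp R.repHom

/-- The embedding of the first factor in `C(𝕋) ⊠ (B ⊠ B)`, as a star homomorphism. -/
def bosBox₁Hom : circleAlg →⋆ₐ[ℂ] R.bosBox ζ := inlHom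

/-- The embedding of `B ⊠ B` in `C(𝕋) ⊠ (B ⊠ B)`, as a star homomorphism. -/
def bosBox₂₃Hom : R.box ζ →⋆ₐ[ℂ] R.bosBox ζ := inrHom

theorem bos₁Hom_apply (a : circleAlg) : R.bos₁Hom ζ a = R.bos₁ ζ a := rfl
theorem bosBox₁Hom_apply (a : circleAlg) : R.bosBox₁Hom ζ a = R.bosBox₁ ζ a := rfl
theorem bosBox₂₃Hom_apply (x : R.box ζ) : R.bosBox₂₃Hom ζ x = R.bosBox₂₃ ζ x := rfl

theorem homog {k : ℤ} {b : B} (h : ∀ w, β w b = ((w ^ k : Circle) : ℂ) • b) :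
    Homog R.deg k (R.ρ b) := fun w => by
  rw [← map_smul, ← h, R.covariant]
  rfl

end CovariantRep

attribute [local instance] CovariantRep.cstarAlgebraBox CovariantRep.cstarAlgebraBos
  CovariantRep.cstarAlgebraBosBox

namespace Datum

variable {n : ℕ} (P : Datum n)

theorem act_mul (v w : Circle) (b : P.Ao) : P.act (v * w) b = P.act v (P.act w b) := by
  have : P.act (v * w) = (P.act v).comp (P.act w) := P.hom_ext fun i j => by
    rw [StarAlgHom.comp_apply, act_u, act_u, map_smul, act_u, smul_smul, ← Circle.coe_mul,
      mul_zpow, mul_comm]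
  exact DFunLike.congr_fun this b

theorem act_one (b : P.Ao) : P.act 1 b = b := by
  have : P.act 1 = StarAlgHom.id ℂ P.Ao := P.hom_ext fun i j => by
    rw [act_u, one_zpow, Circle.coe_one, one_smul]
    rfl
  exact DFunLike.congr_fun this b

variable {P}

theorem Relations.map {D E : Type*} [Ring D] [StarRing D] [Algebra ℂ D] [Ring E] [StarRing E]
    [Algebra ℂ E] (φ : D →⋆ₐ[ℂ] E) {u : Fin n → Fin n → D} (h : P.Relations u) :
    P.Relations fun i j => φ (u i j) := by
  rw [relations_iff] at h ⊢
  intro r i j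
  rw [← map_relator, h, map_zero]

variable (P) in
/-- Closed star subalgebras that contain the generators are everything. -/
theorem eq_top_of_u_mem {A : StarSubalgebra ℂ P.Ao} (hA : IsClosed (A : Set P.Ao))
    (h : ∀ i j, P.u i j ∈ A) (b : P.Ao) : b ∈ A := by
  let _ : CStarAlgebra A := StarSubalgebra.cstarAlgebra _ (h_closed := hA)
  have hr : P.Relations fun i j => (⟨P.u i j, h i j⟩ : A) := by
    have := P.u_relations
    refine ⟨fun i j => Subtype.ext ?_, fun i j => Subtype.ext ?_, fun i j => Subtype.ext ?_⟩
    · simpa [apply_ite] using this.isometry i j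
    · simpa [apply_ite] using this.coisometry i j
    · simpa using this.invariant i j
  -- The universal map into `A`, followed by the inclusion, fixes the generators and is therefore
  -- the identity.
  obtain ⟨φ, hφ⟩ := P.exists_lift _ hr
  have : A.subtype.comp φ = StarAlgHom.id ℂ P.Ao := P.hom_ext fun i j => by
    rw [StarAlgHom.comp_apply, hφ]
    rfl
  rw [← show A.subtype (φ b) = b from DFunLike.congr_fun this b]
  exact (φ b).2

/-! ### Commutation of `z` with the image of `B` -/

section Commutation

variable {D : Type*} [CStarAlgebra D] {z : D} {t : Fin n → Fin n → D}
  {φ : P.Ao →⋆ₐ[ℂ] D}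

/-- Since `z` is unitary, `x ↦ z* x z` is a star homomorphism; on the generators it agrees with
`β_ζ`, hence on all of `B`. -/
theorem BosRelations.mul_z (h : P.BosRelations z t) (hφ : ∀ i j, φ (P.u i j) = t i j) (b : P.Ao) :
    φ b * z = z * φ (P.act P.ζ b) := by
  let c : D →⋆ₐ[ℂ] D := 
    { toFun := fun x => star z * x * z
      map_one' := by rw [mul_one, h.star_mul_self]
      map_mul' := fun x y => by
        rw [show star z * x * z * (star z * y * z) = star z * x * (z * star z) * y * z by
          simp only [mul_assoc], h.mul_star_self, mul_one, mul_assoc (star z) x y]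
      map_zero' := by rw [mul_zero, zero_mul]
      map_add' := fun x y => by rw [mul_add, add_mul]
      commutes' := fun c => by
        rw [← Algebra.commutes, mul_assoc, h.star_mul_self, mul_one]
      map_star' := fun x => by simp [mul_assoc] }
  have : c.comp φ = φ.comp (P.act P.ζ) := P.hom_ext fun i j => by
    change star z * φ (P.u i j) * z = φ (P.act P.ζ (P.u i j))
    have h1 : t i j * z = ((P.ζ ^ (P.deg j - P.deg i) : Circle) : ℂ) • (z * t i j) := by
      rw [h.commutation, smul_smul, ← Circle.coe_mul, ← zpow_add]
      simp
    rw [act_u, map_smul, hφ, mul_assoc, h1, mul_smul_comm, ← mul_assoc, h.star_mul_self, one_mul]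
  have h2 : star z * φ b * z = φ (P.act P.ζ b) := DFunLike.congr_fun this b
  rw [← h2, ← mul_assoc, ← mul_assoc, h.mul_star_self, one_mul]

theorem BosRelations.mul_uzpow (h : P.BosRelations z t) (hφ : ∀ i j, φ (P.u i j) = t i j) (k : ℤ)
    (b : P.Ao) : φ b * uzpow z k = uzpow z k * φ (P.act (P.ζ ^ k) b) := by
  have hz := uzpow_add h.star_mul_self h.mul_star_self
  have h1 := h.mul_z hφ
  have h2 : ∀ b, φ b * star z = star z * φ (P.act P.ζ⁻¹ b) := by
    intro b
    -- Negative powers: the relation for `z`, applied to `β_ζ⁻¹(b)` and multiplied by `z*` on both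
    -- sides.
    have := h1 (P.act P.ζ⁻¹ b)
    rw [← act_mul, mul_inv_cancel, act_one] at this
    rw [← one_mul (φ b), ← h.star_mul_self, mul_assoc (star z), ← this, mul_assoc, mul_assoc,
      h.mul_star_self, mul_one]
  induction k using Int.induction_on generalizing b with
  | zero => rw [zpow_zero, act_one, show uzpow z 0 = 1 from pow_zero z, mul_one, one_mul]
  | succ k ih =>
    rw [hz, ← mul_assoc, ih, mul_assoc, show uzpow z 1 = z from pow_one _, h1, ← act_mul,
      zpow_add, zpow_one, mul_comm (P.ζ ^ (k : ℤ)), mul_assoc]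
  | pred k ih =>
    rw [sub_eq_add_neg, hz, ← mul_assoc, ih, mul_assoc,
      show uzpow z (-1) = star z from pow_one _, h2, ← act_mul, zpow_add, zpow_neg_one,
      mul_comm (P.ζ ^ (-k : ℤ)), mul_assoc]

end Commutation

variable (R : CovariantRep.{u} P.act)

theorem bosZ_relations : star (P.bosZ R) * P.bosZ R = 1 ∧ P.bosZ R * star (P.bosZ R) = 1 := by
  have h : P.bosZ R = R.bos₁Hom P.ζ circleGen := rfl
  rw [h, ← map_star, ← map_mul, ← map_mul]
  constructor
  · rw [show star circleGen * circleGen = 1 from Subtype.ext star_shift_mul_shift, map_one]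
  · rw [show circleGen * star circleGen = 1 from Subtype.ext shift_mul_star_shift, map_one]

theorem bos_relations : P.BosRelations (P.bosZ R) (P.bosU R) where
  star_mul_self := (bosZ_relations R).1
  mul_star_self := (bosZ_relations R).2
  relations := P.u_relations.map (R.bos₂Hom P.ζ)
  commutation i j := by
    have h : P.bosU R i j * P.bosZ R =
        ((P.ζ ^ ((P.deg j - P.deg i) * 1) : Circle) : ℂ) • (P.bosZ R * P.bosU R i j) :=
      inr_mul_inl (R.homog fun w => P.act_u w i j) homog_shift
    rw [h, smul_smul, ← Circle.coe_mul, ← zpow_add]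
    simp

end Datum

/-! ### Generators of braided tensor products -/

theorem isClosed_map_subtype {A : Type*} [CStarAlgebra A] {S : StarSubalgebra ℂ A}
    (hS : IsClosed (S : Set A)) {T : StarSubalgebra ℂ S} (hT : IsClosed (T : Set S)) :
    IsClosed (T.map S.subtype : Set A) :=
  hS.isClosedEmbedding_subtypeVal.isClosedMap _ hT

/-- Braided tensor products are minimal among closed subalgebras of the ambient operator algebra;
this carries the minimality over to subalgebras of the product itself. -/
theorem mem_of_le_map_subtype {A : Type*} [CStarAlgebra A] {S : StarSubalgebra ℂ A}
    {T : StarSubalgebra ℂ S} (h : S ≤ T.map S.subtype) (x : S) : x ∈ T := by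
  obtain ⟨y, hy, hyx⟩ := h x.2
  exact Subtype.ext (a1 := y) (a2 := x) hyx ▸ hy

theorem mem_of_circleGen_mem {A : StarSubalgebra ℂ circleAlg} (hA : IsClosed (A : Set circleAlg))
    (h : circleGen ∈ A) (a : circleAlg) : a ∈ A :=
  mem_of_le_map_subtype (circleAlg_le
    (isClosed_map_subtype (StarAlgebra.elemental.isClosed ℂ shift) hA) ⟨_, h, rfl⟩) a

section BoxTimes

variable {ι κ : Type*} {ζ : Circle} {p : κ → ℤ} {q : ι → ℤ}
  {S : StarSubalgebra ℂ (Op κ)} {T : StarSubalgebra ℂ (Op ι)}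

theorem mem_of_inl_mem_of_inr_mem {A : StarSubalgebra ℂ (boxTimes ζ p q S T)}
    (hA : IsClosed (A : Set (boxTimes ζ p q S T))) (h1 : ∀ a, inl a ∈ A) (h2 : ∀ b, inr b ∈ A)
    (x : boxTimes ζ p q S T) : x ∈ A :=
  mem_of_le_map_subtype (boxTimes_le
    (isClosed_map_subtype (StarSubalgebra.isClosed_topologicalClosure _) hA)
    (fun a ha => ⟨_, h1 ⟨a, ha⟩, rfl⟩) fun b hb => ⟨_, h2 ⟨b, hb⟩, rfl⟩) x

end BoxTimes

theorem isClosed_equalizer {A D : Type*} [CStarAlgebra A] [CStarAlgebra D] (φ ψ : A →⋆ₐ[ℂ] D) :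
    IsClosed (StarAlgHom.equalizer φ ψ : Set A) :=
  isClosed_eq (continuous_starAlgHom φ) (continuous_starAlgHom ψ)

namespace Datum

variable {n : ℕ} {P : Datum n} (R : CovariantRep.{u} P.act)

theorem mem_of_bosZ_mem_of_bosU_mem {A : StarSubalgebra ℂ (R.bos P.ζ)}
    (hA : IsClosed (A : Set (R.bos P.ζ))) (h1 : P.bosZ R ∈ A) (h2 : ∀ i j, P.bosU R i j ∈ A)
    (x : R.bos P.ζ) : x ∈ A := by
  refine mem_of_inl_mem_of_inr_mem hA (fun a => ?_) (fun b => ?_) x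
  · exact mem_of_circleGen_mem (isClosed_comap (R.bos₁Hom P.ζ) hA) h1 a
  · obtain ⟨_, b, rfl⟩ := b
    exact P.eq_top_of_u_mem (isClosed_comap (R.bos₂Hom P.ζ) hA) h2 b

theorem bos_hom_ext {D : Type*} [CStarAlgebra D] {φ ψ : R.bos P.ζ →⋆ₐ[ℂ] D}
    (h1 : φ (P.bosZ R) = ψ (P.bosZ R)) (h2 : ∀ i j, φ (P.bosU R i j) = ψ (P.bosU R i j)) :
    φ = ψ := by
  ext x
  exact mem_of_bosZ_mem_of_bosU_mem R (isClosed_equalizer φ ψ) h1 h2 x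

/-- Evaluation of star polynomials in the generators of the bosonisation. -/
def bosEval {D : Type*} [CStarAlgebra D] (z : D) (t : Fin n → Fin n → D) :
    FreeStar (Option (Fin n × Fin n)) →⋆ₐ[ℂ] D :=
  FreeStar.eval fun o => o.elim z fun x => t x.1 x.2

theorem bosEval_none {D : Type*} [CStarAlgebra D] (z : D) (t : Fin n → Fin n → D) :
    bosEval z t (FreeStar.gen none) = z := FreeStar.eval_gen _ _

theorem bosEval_some {D : Type*} [CStarAlgebra D] (z : D) (t : Fin n → Fin n → D)
    (x : Fin n × Fin n) : bosEval z t (FreeStar.gen (some x)) = t x.1 x.2 := FreeStar.eval_gen _ _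

theorem denseRange_bosEval : DenseRange (bosEval (P.bosZ R) (P.bosU R)) := by
  intro x
  have h := fun x => StarSubalgebra.le_topologicalClosure
    (bosEval (P.bosZ R) (P.bosU R)).range (x := bosEval (P.bosZ R) (P.bosU R) x) ⟨x, rfl⟩
  refine mem_of_bosZ_mem_of_bosU_mem R (StarSubalgebra.isClosed_topologicalClosure
    (bosEval (P.bosZ R) (P.bosU R)).range) ?_ (fun i j => ?_) x
  · have := h (FreeStar.gen none)
    rwa [bosEval_none] at this
  · have := h (FreeStar.gen (some (i, j)))
    rwa [bosEval_some] at this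

/-! ### Comparison of `C(𝕋) ⊠ B` with another solution of the relations -/

section Lift

variable {D : Type*} [CStarAlgebra D] {z : D} {t : Fin n → Fin n → D}
  {φ : P.Ao →⋆ₐ[ℂ] D}

variable (z t φ) in
/-- The star polynomials whose values at the generators of the bosonisation and at `z`, `t` are of
the form `z^k b` for the same `b` in the universal C*-algebra. -/
def bosGrading (k : ℤ) : Submodule ℂ (FreeStar (Option (Fin n × Fin n))) where
  carrier := {x | ∃ b : P.Ao,
    bosEval (P.bosZ R) (P.bosU R) x = uzpow (P.bosZ R) k * R.bos₂Hom P.ζ b ∧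
      bosEval z t x = uzpow z k * φ b}
  add_mem' := by
    rintro x y ⟨b, hb, hb'⟩ ⟨c, hc, hc'⟩
    exact ⟨b + c, by rw [map_add, hb, hc, map_add, mul_add],
      by rw [map_add, hb', hc', map_add, mul_add]⟩
  zero_mem' := ⟨0, by simp, by simp⟩
  smul_mem' := by
    rintro r x ⟨b, hb, hb'⟩
    exact ⟨r • b, by rw [map_smul, hb, map_smul, mul_smul_comm],
      by rw [map_smul, hb', map_smul, mul_smul_comm]⟩

/-- This is the crossed product multiplication. The twist is computed in `B` and does not depend on
`D`, so products keep a common coefficient in `C` and in `D`; this makes `bosGrading`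
multiplicative. -/
theorem BosRelations.uzpow_mul_mul (h : P.BosRelations z t) (hφ : ∀ i j, φ (P.u i j) = t i j)
    (k l : ℤ) (b c : P.Ao) : uzpow z k * φ b * (uzpow z l * φ c) =
      uzpow z (k + l) * φ (P.act (P.ζ ^ l) b * c) := by
  rw [mul_assoc, ← mul_assoc (φ b), h.mul_uzpow hφ, mul_assoc, ← mul_assoc,
    ← uzpow_add h.star_mul_self h.mul_star_self, ← map_mul]

theorem BosRelations.star_uzpow_mul (h : P.BosRelations z t) (hφ : ∀ i j, φ (P.u i j) = t i j)
    (k : ℤ) (b : P.Ao) : star (uzpow z k * φ b) =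
      uzpow z (-k) * φ (P.act (P.ζ ^ (-k)) (star b)) := by
  rw [star_mul, star_uzpow h.star_mul_self h.mul_star_self, ← map_star, h.mul_uzpow hφ]

theorem bosGrading_mul (h : P.BosRelations z t) (hφ : ∀ i j, φ (P.u i j) = t i j) (k l : ℤ)
    (x y : FreeStar (Option (Fin n × Fin n))) (hx : x ∈ bosGrading R z t φ k)
    (hy : y ∈ bosGrading R z t φ l) : x * y ∈ bosGrading R z t φ (k + l) := by
  obtain ⟨b, hb, hb'⟩ := hx
  obtain ⟨c, hc, hc'⟩ := hy
  refine ⟨P.act (P.ζ ^ l) b * c, ?_, ?_⟩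
  · rw [map_mul, hb, hc]
    exact (bos_relations R).uzpow_mul_mul (fun _ _ => rfl) k l b c
  · rw [map_mul, hb', hc', h.uzpow_mul_mul hφ]

theorem bosGrading_star (h : P.BosRelations z t) (hφ : ∀ i j, φ (P.u i j) = t i j) (k : ℤ)
    (x : FreeStar (Option (Fin n × Fin n))) (hx : x ∈ bosGrading R z t φ k) :
    star x ∈ bosGrading R z t φ (-k) := by
  obtain ⟨b, hb, hb'⟩ := hx
  refine ⟨P.act (P.ζ ^ (-k)) (star b), ?_, ?_⟩
  · rw [map_star, hb]
    exact (bos_relations R).star_uzpow_mul (fun _ _ => rfl) k b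
  · rw [map_star, hb', h.star_uzpow_mul hφ]

theorem one_mem_bosGrading : 1 ∈ bosGrading R z t φ 0 := by
  refine ⟨1, ?_, ?_⟩
  · rw [map_one, map_one, show uzpow (P.bosZ R) 0 = 1 from pow_zero _, mul_one]
  · rw [map_one, map_one, show uzpow z 0 = 1 from pow_zero _, mul_one]

theorem gen_mem_bosGrading (hφ : ∀ i j, φ (P.u i j) = t i j) (o : Option (Fin n × Fin n)) :
    ∃ k, FreeStar.gen o ∈ bosGrading R z t φ k := by
  rcases o with _ | x
  · refine ⟨1, 1, ?_, ?_⟩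
    · rw [bosEval_none, map_one, mul_one]; exact (pow_one _).symm
    · rw [bosEval_none, map_one, mul_one]; exact (pow_one _).symm
  · refine ⟨0, P.u x.1 x.2, ?_, ?_⟩
    · rw [bosEval_some, show uzpow (P.bosZ R) 0 = 1 from pow_zero _, one_mul]
      rfl
    · rw [bosEval_some, show uzpow z 0 = 1 from pow_zero _, one_mul, hφ]

theorem mem_window_bosGrading (h : P.BosRelations z t) (hφ : ∀ i j, φ (P.u i j) = t i j)
    (x : FreeStar (Option (Fin n × Fin n))) : ∃ M, x ∈ window (bosGrading R z t φ) M :=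
  exists_mem_window (bosGrading_mul R h hφ) (one_mem_bosGrading R) (bosGrading_star R h hφ)
    (gen_mem_bosGrading R hφ) x

theorem coe_uzpow_bosZ (k : ℤ) :
    ((uzpow (P.bosZ R) k : R.bos P.ζ) : Op (ℤ × R.ι)) = amp R.ι (uzpow shift k) :=
  (map_uzpow (R.bos P.ζ).subtype _ k).trans (map_uzpow (ampHom R.ι) shift k).symm

theorem coe_uzpow_bosZ_mul (k : ℤ) (b : P.Ao) :
    ((uzpow (P.bosZ R) k * R.bos₂Hom P.ζ b : R.bos P.ζ) : Op (ℤ × R.ι)) =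
      amp R.ι (uzpow shift k) * braidedAmp P.ζ id R.deg (R.ρ b) := by
  rw [← coe_uzpow_bosZ]
  rfl

/-- The unitary powers cancel in `(z^k φ(b_k))* (z^k φ(b_k))`, leaving the image under the
contraction `φ` of an element of `B`, to which the lower bound in `C` applies. -/
theorem norm_sum_le_norm_bosEval (h : P.BosRelations z t) (s : Finset ℤ)
    (x : ∀ k, bosGrading R z t φ k) :
    ‖∑ k ∈ s, star (bosEval z t (x k)) * bosEval z t (x k)‖ ≤
      ‖bosEval (P.bosZ R) (P.bosU R) (∑ k ∈ s, (x k : FreeStar (Option (Fin n × Fin n))))‖ ^ 2 := by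
  choose b hb hb' using fun k => (x k).2
  have h1 : ∀ k, star (bosEval z t (x k)) * bosEval z t (x k) = φ (star (b k) * b k) := by
    intro k
    rw [hb', star_mul, mul_assoc, ← mul_assoc (star (uzpow z k)),
      star_uzpow_mul_uzpow h.star_mul_self h.mul_star_self, one_mul, map_mul, map_star]
  have h2 : ‖bosEval (P.bosZ R) (P.bosU R) (∑ k ∈ s, (x k : FreeStar (Option (Fin n × Fin n))))‖ =
      ‖∑ k ∈ s, amp R.ι (uzpow shift k) * braidedAmp P.ζ id R.deg (R.ρ (b k))‖ := by
    rw [map_sum]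
    simp only [hb]
    refine Eq.trans (b := ‖(((∑ k ∈ s, uzpow (P.bosZ R) k * R.bos₂Hom P.ζ (b k) : R.bos P.ζ)) :
      Op (ℤ × R.ι))‖) rfl ?_
    rw [AddSubmonoidClass.coe_finsetSum]
    simp only [coe_uzpow_bosZ_mul]
  simp only [h1]
  rw [h2, ← map_sum]
  refine (NonUnitalStarAlgHom.norm_apply_le φ _).trans ?_
  -- Faithfulness enters here: `ρ` is isometric, so the norm in `B` is an operator norm.
  rw [← NonUnitalStarAlgHom.norm_map R.ρ R.injective, map_sum]
  simp only [map_mul, map_star]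
  exact norm_sum_star_mul_le s _

theorem exists_bos_lift (h : P.BosRelations z t) : ∃ Φ : R.bos P.ζ →⋆ₐ[ℂ] D,
    Φ (P.bosZ R) = z ∧ ∀ i j, Φ (P.bosU R i j) = t i j := by
  obtain ⟨φ, hφ⟩ := P.exists_lift t h.relations
  obtain ⟨Φ, hΦ⟩ := exists_factor (bosEval z t) (bosEval (P.bosZ R) (P.bosU R))
    (denseRange_bosEval R) fun x => by
      obtain ⟨M, hM⟩ := mem_window_bosGrading R h hφ x
      exact norm_le_of_grading _ _ (bosGrading_mul R h hφ) (one_mem_bosGrading R)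
        (bosGrading_star R h hφ) (norm_sum_le_norm_bosEval R h) hM
  refine ⟨Φ, ?_, fun i j => ?_⟩
  · have := hΦ (FreeStar.gen none)
    rwa [bosEval_none, bosEval_none] at this
  · have := hΦ (FreeStar.gen (some (i, j)))
    rwa [bosEval_some, bosEval_some] at this

end Lift

theorem dense_span_bos : Dense (Submodule.span ℂ
    {x : R.bos P.ζ | ∃ a b, x = R.bos₁ P.ζ a * R.bos₂ P.ζ b} : Set (R.bos P.ζ)) := by
  refine (denseRange_bosEval R).mono ?_
  rintro _ ⟨x, rfl⟩
  -- Only the decomposition in `C` is of interest, so `C` itself serves as the target.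
  obtain ⟨M, hM⟩ := mem_window_bosGrading R (bos_relations R) (φ := R.bos₂Hom P.ζ)
    (fun _ _ => rfl) x
  obtain ⟨μ, rfl⟩ := (Submodule.mem_iSup_finset_iff_exists_sum _ _).1 hM
  rw [map_sum]
  refine Submodule.sum_mem _ fun k _ => Submodule.subset_span ?_
  obtain ⟨b, hb, -⟩ := (μ k).2
  refine ⟨uzpow circleGen k, b, hb.trans ?_⟩
  rw [← CovariantRep.bos₁Hom_apply, map_uzpow]
  rfl

end Datum

/-! ### The comultiplications -/

namespace Datum

variable {n : ℕ} {P : Datum n}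

/-- The product of two families that satisfy the defining relations and commute up to the phases
prescribed by the braiding satisfies the defining relations. -/
theorem Relations.mul {D : Type*} [Ring D] [StarRing D] [Algebra ℂ D] [StarModule ℂ D]
    {a b : Fin n → Fin n → D} (ha : P.Relations a) (hb : P.Relations b)
    (hab : ∀ i j k l, star (b i j) * a k l =
      ((P.ζ ^ ((P.deg i - P.deg j) * (P.deg l - P.deg k)) : Circle) : ℂ) •
        (a k l * star (b i j))) :
    P.Relations fun i k => ∑ l, a i l * b l k := by
  refine ⟨fun i j => ?_, fun i j => ?_, fun i j => ?_⟩
  · have h : ∀ k, star (∑ l, a k l * b l i) * ∑ m, a k m * b m j =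
        ∑ l, ∑ m, star (b l i) * (star (a k l) * a k m) * b m j := fun k => by
      rw [star_sum, Finset.sum_mul_sum]
      simp only [star_mul, mul_assoc]
    simp only [h]
    rw [Finset.sum_comm]
    have h' : ∀ l, ∑ k, ∑ m, star (b l i) * (star (a k l) * a k m) * b m j =
        star (b l i) * b l j := fun l => by
      rw [Finset.sum_comm]
      simp only [← Finset.sum_mul, ← Finset.mul_sum, ha.isometry]
      simp
    simp only [h', hb.isometry]
  · have h : ∀ k, (∑ l, a i l * b l k) * star (∑ m, a j m * b m k) =
        ∑ l, ∑ m, a i l * (b l k * star (b m k)) * star (a j m) := fun k => by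
      rw [star_sum, Finset.sum_mul_sum]
      simp only [star_mul, mul_assoc]
    simp only [h]
    rw [Finset.sum_comm]
    have h' : ∀ l, ∑ k, ∑ m, a i l * (b l k * star (b m k)) * star (a j m) =
        a i l * star (a j l) := fun l => by
      rw [Finset.sum_comm]
      simp only [← Finset.sum_mul, ← Finset.mul_sum, hb.coisometry]
      simp
    simp only [h', ha.coisometry]
  · have hz : ∀ k l : ℤ, ((P.ζ ^ k : Circle) : ℂ) * ((P.ζ ^ l : Circle) : ℂ) =
        ((P.ζ ^ (k + l) : Circle) : ℂ) := fun k l => by rw [← Circle.coe_mul, ← zpow_add]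
    have hb' : ∀ l, ∑ k, P.ω i k • b l k =
        ((P.ζ ^ (P.deg l * (P.d - P.deg l) - P.deg l * P.deg i) : Circle) : ℂ) •
          ∑ k, P.ω k l • star (b k i) := fun l => by
      have := congrArg (fun x => ((P.ζ ^ (-(P.deg l * P.deg i)) : Circle) : ℂ) • x)
        (hb.invariant i l)
      simp only [smul_smul, hz] at this
      rw [neg_add_cancel, zpow_zero, Circle.coe_one, one_smul] at this
      rw [this]
      exact congrArg (fun m : ℤ => ((P.ζ ^ m : Circle) : ℂ) • ∑ k, P.ω k l • star (b k i)) (by ring)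
    have h1 : ∑ k, P.ω i k • ∑ l, a j l * b l k =
        ∑ l, a j l * ∑ k, P.ω i k • b l k := by
      simp only [Finset.smul_sum, Finset.mul_sum, mul_smul_comm]
      exact Finset.sum_comm
    have h2 : ∑ k, P.ω k j • star (∑ l, a k l * b l i) =
        ∑ l, star (b l i) * ∑ k, P.ω k j • star (a k l) := by
      simp only [star_sum, star_mul, Finset.smul_sum, Finset.mul_sum, mul_smul_comm]
      exact Finset.sum_comm
    -- Where `ω_kl ≠ 0`, homogeneity gives `d - d_l = d_k`; then the phase from the relation for `b`
    -- and the phase of the commutation combine to `ζ^(d_j d_k)`, as the relation for `a` at `(k,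
    -- j)` requires.
    have h3 : ∀ k l, ((P.ζ ^ (P.deg j * P.deg i) : Circle) : ℂ) •
        (((P.ζ ^ (P.deg l * (P.d - P.deg l) - P.deg l * P.deg i) : Circle) : ℂ) •
          (P.ω k l • (a j l * star (b k i)))) =
        ((P.ζ ^ (P.deg j * P.deg k) : Circle) : ℂ) • (P.ω k l • (star (b k i) * a j l)) := by
      intro k l
      by_cases h : P.ω k l = 0
      · simp [h]
      · rw [hab, ← P.homogeneous k l h]
        simp only [smul_comm (P.ω k l), smul_smul, ← mul_assoc, hz]
        congr 4; ring
    rw [h1, h2]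
    simp only [hb', Finset.smul_sum, Finset.mul_sum, mul_smul_comm, h3]
    rw [Finset.sum_comm]
    refine Finset.sum_congr rfl fun k _ => ?_
    have := congrArg (fun x => star (b k i) * x) (ha.invariant k j)
    simpa only [mul_smul_comm, Finset.mul_sum, Finset.smul_sum] using this

variable (R : CovariantRep.{u} P.act)

theorem box_relations :
    P.Relations fun i k => ∑ l, R.box₁ P.ζ (P.u i l) * R.box₂ P.ζ (P.u l k) := by
  refine (P.u_relations.map (R.box₁Hom P.ζ)).mul (P.u_relations.map (R.box₂Hom P.ζ)) ?_
  intro i j k l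
  change star (R.box₂Hom P.ζ (P.u i j)) * _ = _ • (_ * star (R.box₂Hom P.ζ (P.u i j)))
  rw [← map_star]
  have h : Homog R.deg (P.deg i - P.deg j) (R.ρ (star (P.u i j))) := by
    rw [map_star, ← neg_sub]
    exact (R.homog fun w => P.act_u w i j).star
  exact inr_mul_inl (b := R.rep (star (P.u i j))) h (R.homog fun w => P.act_u w k l)

theorem existsUnique_comult : ∃! Δ : P.Ao →⋆ₐ[ℂ] R.box P.ζ, P.IsComult R Δ := by
  obtain ⟨Δ, hΔ⟩ := P.exists_lift _ (box_relations R)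
  exact ⟨Δ, hΔ, fun Δ' hΔ' => P.hom_ext fun i j => (hΔ' i j).trans (hΔ i j).symm⟩

theorem coe_sum_box (i k : Fin n) :
    ((∑ l, R.box₁ P.ζ (P.u i l) * R.box₂ P.ζ (P.u l k) : R.box P.ζ) : Op (R.ι × R.ι)) =
      ∑ l, amp R.ι (R.ρ (P.u i l)) * braidedAmp P.ζ R.deg R.deg (R.ρ (P.u l k)) :=
  map_sum (R.box P.ζ).subtype _ _

/-- Every summand has the same total degree, because `d_l` cancels. This provides the commutation
with `z` in `C(𝕋) ⊠ (B ⊠ B)`. -/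
theorem homog_comult {Δ : P.Ao →⋆ₐ[ℂ] R.box P.ζ} (hΔ : P.IsComult R Δ) (i k : Fin n) :
    Homog (fun x : R.ι × R.ι => R.deg x.1 + R.deg x.2) (P.deg k - P.deg i)
      (Δ (P.u i k) : Op (R.ι × R.ι)) := by
  rw [hΔ, coe_sum_box]
  refine Homog.sum fun l _ => ?_
  rw [show P.deg k - P.deg i = (P.deg l - P.deg i) + (P.deg k - P.deg l) by ring]
  exact (R.homog fun w => P.act_u w i l).amp.mul (R.homog fun w => P.act_u w l k).braidedAmp

/-- The universal property of `C` reduces the existence of `id ⊠ Δ` to relations between the images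
of the generators. -/
theorem exists_isIdBox {Δ : P.Ao →⋆ₐ[ℂ] R.box P.ζ} (hΔ : P.IsComult R Δ) :
    ∃ Θ, R.IsIdBox P.ζ Δ Θ := by
  have h : P.BosRelations (R.bosBox₁ P.ζ circleGen)
      fun i j => R.bosBox₂₃ P.ζ (Δ (P.u i j)) := by
    refine ⟨?_, ?_, P.u_relations.map ((R.bosBox₂₃Hom P.ζ).comp Δ), fun i j => ?_⟩
    · rw [← CovariantRep.bosBox₁Hom_apply, ← map_star, ← map_mul,
        show star circleGen * circleGen = 1 from Subtype.ext star_shift_mul_shift, map_one]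
    · rw [← CovariantRep.bosBox₁Hom_apply, ← map_star, ← map_mul,
        show circleGen * star circleGen = 1 from Subtype.ext shift_mul_star_shift, map_one]
    · have h : R.bosBox₂₃ P.ζ (Δ (P.u i j)) * R.bosBox₁ P.ζ circleGen =
          ((P.ζ ^ ((P.deg j - P.deg i) * 1) : Circle) : ℂ) •
            (R.bosBox₁ P.ζ circleGen * R.bosBox₂₃ P.ζ (Δ (P.u i j))) :=
        inr_mul_inl (homog_comult R hΔ i j) homog_shift
      rw [h, smul_smul, ← Circle.coe_mul, ← zpow_add]
      simp
  obtain ⟨Θ, h1, h2⟩ := exists_bos_lift R h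
  refine ⟨Θ, fun a => ?_, fun b => ?_⟩
  · have : Θ.comp (R.bos₁Hom P.ζ) = R.bosBox₁Hom P.ζ := circleAlg_hom_ext h1
    exact DFunLike.congr_fun this a
  · have : Θ.comp (R.bos₂Hom P.ζ) = (R.bosBox₂₃Hom P.ζ).comp Δ := P.hom_ext h2
    exact DFunLike.congr_fun this b

end Datum

/-! ### The splitting homomorphism -/

section Splitting

variable {ι : Type*} (ζ : Circle) (q : ι → ℤ)

/-- The relabelling `((m, a, b), s) ↦ ((m, a), (s + m + deg a, b))`. -/
def splitEquiv : (ℤ × (ι × ι)) × ℤ ≃ (ℤ × ι) × (ℤ × ι) where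
  -- The new `ℤ`-coordinate moves with the total degree `m + deg a`: raising the degree of either
  -- first leg by `k` shifts it by `k`, which produces the factor `z^k` of the coaction.
  toFun x := ((x.1.1, x.1.2.1), (x.2 + x.1.1 + q x.1.2.1, x.1.2.2))
  invFun y := ((y.1.1, (y.1.2, y.2.2)), y.2.1 - y.1.1 - q y.1.2)
  left_inv x := by
    ext <;> simp
    ring
  right_inv y := by
    ext <;> simp
    ring

/-- The unitary that implements the splitting homomorphism. -/
def splitUnitary : L2 ((ℤ × (ι × ι)) × ℤ) ≃ₗᵢ[ℂ] L2 ((ℤ × ι) × (ℤ × ι)) :=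
  -- The third factor should be braided with the new coordinate `s + m + deg a`, but the braiding
  -- only sees `m + deg a`; this phase supplies the part due to `s`.
  phasePerm (splitEquiv q) fun x => ζ ^ (x.2 * q x.1.2.2)

/-- The splitting homomorphism on bounded operators. -/
def splitHom : Op (ℤ × (ι × ι)) →⋆ₐ[ℂ] Op ((ℤ × ι) × (ℤ × ι)) :=
  (conjHom (splitUnitary ζ q)).comp (ampHom ℤ)

variable {ζ q}

theorem slice_splitUnitary_symm (g : L2 ((ℤ × ι) × (ℤ × ι))) (s m : ℤ) (a b : ι) :
    slice ((splitUnitary ζ q).symm g) s (m, (a, b)) =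
      (((ζ ^ (s * q b))⁻¹ : Circle) : ℂ) * g ((m, a), (s + m + q a, b)) := by
  rw [slice_apply, splitUnitary, phasePerm_symm_apply]
  rfl

theorem splitHom_apply (T : Op (ℤ × (ι × ι))) (g : L2 ((ℤ × ι) × (ℤ × ι))) (m m' : ℤ) (a b : ι) :
    splitHom ζ q T g ((m, a), (m', b)) = ((ζ ^ ((m' - m - q a) * q b) : Circle) : ℂ) *
      T (slice ((splitUnitary ζ q).symm g) (m' - m - q a)) (m, (a, b)) := rfl

theorem splitHom_amp_shift : splitHom ζ q (amp (ι × ι) shift) =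
    amp (ℤ × ι) (amp ι shift) * braidedAmp 1 (0 : ℤ × ι → ℤ) (0 : ℤ × ι → ℤ) (amp ι shift) := by
  ext g ⟨⟨m, a⟩, ⟨m', b⟩⟩
  rw [splitHom_apply, amp_apply, shift_apply, slice_apply, slice_splitUnitary_symm, ← mul_assoc,
    ← Circle.coe_mul, mul_inv_cancel, Circle.coe_one, one_mul, mul_apply_eq_comp, amp_apply,
    amp_apply, shift_apply, slice_apply, slice_apply, braidedAmp_one_apply', amp_apply,
    shift_apply, slice_apply, rslice_apply]
  exact congrArg (fun y => g ((m - 1, a), (y, b))) (by ring)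

variable {k : ℤ} {c : Op ι}

/-- The two braidings contribute `ζ^(k (m + deg a))`, and moving `c` past the phase of
`splitUnitary` contributes `ζ^(k s)`; the product is `ζ^(k m')`, the braiding with the second copy
of `ℤ`. -/
theorem splitHom_braidedAmp_braidedAmp (hc : Homog q k c) :
    splitHom ζ q (braidedAmp ζ id (fun x : ι × ι => q x.1 + q x.2) (braidedAmp ζ q q c)) =
      braidedAmp 1 (0 : ℤ × ι → ℤ) (0 : ℤ × ι → ℤ) (braidedAmp ζ id q c) := by
  ext g ⟨⟨m, a⟩, ⟨m', b⟩⟩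
  set s := m' - m - q a with hs
  have h : rslice (rslice (slice ((splitUnitary ζ q).symm g) s) m) a =
      phase q (ζ ^ s)⁻¹ (rslice (rslice g (m, a)) m') := by
    ext b'
    rw [rslice_apply, rslice_apply, slice_splitUnitary_symm, phase_apply, rslice_apply,
      rslice_apply, inv_zpow, ← zpow_mul, show s + m + q a = m' by rw [hs]; ring]
  rw [splitHom_apply, hc.braidedAmp.braidedAmp_apply, hc.braidedAmp_apply, ← hs, h,
    braidedAmp_one_apply', hc.braidedAmp_apply]
  have h2 := congrArg (fun f : L2 ι => f b)
    (hc.phase_comm (ζ ^ s) (phase q (ζ ^ s)⁻¹ (rslice (rslice g (m, a)) m')))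
  simp only [phase_apply_inv] at h2
  rw [phase_apply, ← zpow_mul, ← zpow_mul, lp.coeFn_smul, Pi.smul_apply, smul_eq_mul] at h2
  have h3 : ∀ x : ℂ, ((ζ ^ (s * q b) : Circle) : ℂ) * (((ζ ^ (k * id m) : Circle) : ℂ) *
      (((ζ ^ (k * q a) : Circle) : ℂ) * x)) = ((ζ ^ (k * (m + q a)) : Circle) : ℂ) *
        (((ζ ^ (s * q b) : Circle) : ℂ) * x) := fun x => by
    rw [mul_add, zpow_add, Circle.coe_mul]
    simp only [id]
    ring
  rw [h3, h2, ← mul_assoc, ← Circle.coe_mul, ← zpow_add]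
  congr 4
  rw [hs, id]; ring

theorem splitHom_braidedAmp_amp (hc : Homog q k c) :
    splitHom ζ q (braidedAmp ζ id (fun x : ι × ι => q x.1 + q x.2) (amp ι c)) =
      amp (ℤ × ι) (braidedAmp ζ id q c) *
        braidedAmp 1 (0 : ℤ × ι → ℤ) (0 : ℤ × ι → ℤ) (amp ι (uzpow shift k)) := by
  ext g ⟨⟨m, a⟩, ⟨m', b⟩⟩
  set s := m' - m - q a with hs
  rw [splitHom_apply, hc.amp.braidedAmp_apply, amp_apply, ← hs, mul_apply_eq_comp, amp_apply,
    hc.braidedAmp_apply, ← mul_assoc, mul_comm ((ζ ^ (s * q b) : Circle) : ℂ), mul_assoc,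
    ← smul_eq_mul ((ζ ^ (s * q b) : Circle) : ℂ), ← Pi.smul_apply, ← lp.coeFn_smul, ← map_smul]
  congr 1
  -- Only `a'` with `deg a' + k = deg a` contribute, and for these `s + m + deg a' = m' - k`, which
  -- is the shift by `k`.
  refine hc.apply_congr a fun a' ha' => ?_
  rw [lp.coeFn_smul, Pi.smul_apply, smul_eq_mul, slice_apply, rslice_apply,
    slice_splitUnitary_symm, ← mul_assoc, ← Circle.coe_mul, mul_inv_cancel, Circle.coe_one,
    one_mul, rslice_apply, slice_apply, braidedAmp_one_apply', amp_apply, uzpow_shift_apply,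
    slice_apply, rslice_apply]
  exact congrArg (fun y => g ((m, a'), (y, b))) (by rw [hs, ← ha']; ring)

end Splitting

namespace Datum

variable {n : ℕ} {P : Datum n} (R : CovariantRep.{u} P.act)

theorem isClosed_minTensor :
    IsClosed (minTensor (R.bos P.ζ) (R.bos P.ζ) : Set (Op ((ℤ × R.ι) × (ℤ × R.ι)))) :=
  StarSubalgebra.isClosed_topologicalClosure _

/-- The preimage is closed, so it suffices to treat the shift and the two copies of the `u_ij`.
These are homogeneous, and the explicit formulas for `splitHom` apply. -/
theorem bosBox_le_comap :
    R.bosBox P.ζ ≤ (minTensor (R.bos P.ζ) (R.bos P.ζ)).comap (splitHom P.ζ R.deg) := by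
  have hC := isClosed_comap (splitHom P.ζ R.deg) (isClosed_minTensor R)
  refine boxTimes_le hC (fun a ha => ?_) fun x hx => ?_
  · refine circleAlg_le (isClosed_comap (ampHom (R.ι × R.ι)) hC) ?_ ha
    change splitHom P.ζ R.deg (amp (R.ι × R.ι) shift) ∈ minTensor (R.bos P.ζ) (R.bos P.ζ)
    rw [splitHom_amp_shift]
    exact (tmul (R.bos₁ P.ζ circleGen) (R.bos₁ P.ζ circleGen)).2
  · have hB := isClosed_comap (braidedHom P.ζ id fun x : R.ι × R.ι => R.deg x.1 + R.deg x.2) hC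
    refine boxTimes_le hB ?_ ?_ hx
    · rintro _ ⟨b, rfl⟩
      refine P.eq_top_of_u_mem (isClosed_comap ((ampHom R.ι).comp R.ρ) hB) (fun i j => ?_) b
      change splitHom P.ζ R.deg (braidedAmp P.ζ id (fun x : R.ι × R.ι => R.deg x.1 + R.deg x.2)
        (amp R.ι (R.ρ (P.u i j)))) ∈ minTensor (R.bos P.ζ) (R.bos P.ζ)
      rw [splitHom_braidedAmp_amp (R.homog fun w => P.act_u w i j)]
      rw [← coe_uzpow_bosZ R]
      exact (tmul (R.bos₂ P.ζ (P.u i j)) (uzpow (P.bosZ R) (P.deg j - P.deg i))).2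
    · rintro _ ⟨b, rfl⟩
      refine P.eq_top_of_u_mem (isClosed_comap ((braidedHom P.ζ R.deg R.deg).comp R.ρ) hB)
        (fun i j => ?_) b
      change splitHom P.ζ R.deg (braidedAmp P.ζ id (fun x : R.ι × R.ι => R.deg x.1 + R.deg x.2)
        (braidedAmp P.ζ R.deg R.deg (R.ρ (P.u i j)))) ∈ minTensor (R.bos P.ζ) (R.bos P.ζ)
      rw [splitHom_braidedAmp_braidedAmp (R.homog fun w => P.act_u w i j)]
      exact (inr (R.bos₂ P.ζ (P.u i j)) : minTensor (R.bos P.ζ) (R.bos P.ζ)).2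

/-- The splitting homomorphism `C(𝕋) ⊠ B ⊠ B → (C(𝕋) ⊠ B) ⊗ (C(𝕋) ⊠ B)`. -/
def splitting : R.bosBox P.ζ →⋆ₐ[ℂ] minTensor (R.bos P.ζ) (R.bos P.ζ) :=
  ((splitHom P.ζ R.deg).comp (R.bosBox P.ζ).subtype).codRestrict _ fun x => bosBox_le_comap R x.2

theorem tmul_one_bos₂ (b : P.Ao) : (tmul 1 (R.bos₂ P.ζ b) : minTensor (R.bos P.ζ) (R.bos P.ζ)) =
    inrHom (R.bos₂Hom P.ζ b) := by
  have : (inl 1 : minTensor (R.bos P.ζ) (R.bos P.ζ)) = 1 := map_one inlHom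
  rw [tmul, this, one_mul]
  rfl

theorem isSplitting_splitting : R.IsSplitting P.ζ (splitting R) where
  fst := Subtype.ext splitHom_amp_shift
  snd k b hb := by
    refine Subtype.ext ((splitHom_braidedAmp_amp (R.homog hb)).trans ?_)
    rw [← coe_uzpow_bosZ R]
    rfl
  -- Here `b` is arbitrary; both sides are star homomorphisms in `b`, so the homogeneous generators
  -- suffice.
  trd b := by
    rw [tmul_one_bos₂]
    have : (splitting R).comp ((R.bosBox₂₃Hom P.ζ).comp (R.box₂Hom P.ζ)) =
        inrHom.comp (R.bos₂Hom P.ζ) := P.hom_ext fun i j =>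
      Subtype.ext (splitHom_braidedAmp_braidedAmp (R.homog fun w => P.act_u w i j))
    exact DFunLike.congr_fun this b

theorem tmul_mul_tmul_one (a x : R.bos P.ζ) (b : P.Ao) :
    (tmul a x * tmul 1 (R.bos₂ P.ζ b) : minTensor (R.bos P.ζ) (R.bos P.ζ)) =
      tmul a (x * R.bos₂ P.ζ b) := by
  rw [tmul_one_bos₂, tmul, tmul, mul_assoc]
  exact congrArg _ (map_mul inrHom x (R.bos₂ P.ζ b)).symm

variable {R} in
theorem bosonisationComult_apply {Δ : P.Ao →⋆ₐ[ℂ] R.box P.ζ} (hΔ : P.IsComult R Δ)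
    {ΔC : R.bos P.ζ →⋆ₐ[ℂ] minTensor (R.bos P.ζ) (R.bos P.ζ)}
    (h : R.IsBosonisationComult P.ζ Δ ΔC) :
    ΔC (P.bosZ R) = tmul (P.bosZ R) (P.bosZ R) ∧
      ∀ i k, ΔC (P.bosU R i k) =
        ∑ l, tmul (P.bosU R i l) (uzpow (P.bosZ R) (P.deg l - P.deg i) * P.bosU R l k) := by
  obtain ⟨Θ, ψ, hΘ, hψ, rfl⟩ := h
  refine ⟨(congrArg ψ (hΘ.left circleGen)).trans hψ.fst, fun i k => ?_⟩
  refine (congrArg ψ (hΘ.right (P.u i k))).trans ?_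
  rw [hΔ, ← CovariantRep.bosBox₂₃Hom_apply, map_sum, map_sum]
  refine Finset.sum_congr rfl fun l _ => ?_
  rw [map_mul, map_mul, CovariantRep.bosBox₂₃Hom_apply, CovariantRep.bosBox₂₃Hom_apply, hψ.trd,
    hψ.snd (P.deg l - P.deg i) (P.u i l) fun w => P.act_u w i l]
  exact tmul_mul_tmul_one R _ _ _

/-- For uniqueness, the values on generators follow from the properties of `id ⊠ Δ` and `ψ` alone,
whichever homomorphisms with these properties are chosen. -/
theorem existsUnique_bosonisationComult {Δ : P.Ao →⋆ₐ[ℂ] R.box P.ζ} (hΔ : P.IsComult R Δ) :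
    ∃! ΔC, R.IsBosonisationComult P.ζ Δ ΔC := by
  obtain ⟨Θ, hΘ⟩ := exists_isIdBox R hΔ
  have h : R.IsBosonisationComult P.ζ Δ ((splitting R).comp Θ) :=
    ⟨Θ, splitting R, hΘ, isSplitting_splitting R, rfl⟩
  refine ⟨_, h, fun ΔC hC => bos_hom_ext R ?_ fun i k => ?_⟩
  · rw [(bosonisationComult_apply hΔ h).1, (bosonisationComult_apply hΔ hC).1]
  · rw [(bosonisationComult_apply hΔ h).2, (bosonisationComult_apply hΔ hC).2]

end Datum

/-! ### Faithful representations -/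

section GNS

open scoped ComplexOrder ComplexStarModule

variable {B : Type*} [CStarAlgebra B]

/-- The complex linear extension of a real functional on the self-adjoint part. -/
def complexify (g : B →ₗ[ℝ] ℝ) : B →ₗ[ℂ] ℂ where
  toFun x := (g (ℜ x : B) : ℂ) + g (ℑ x : B) * Complex.I
  map_add' x y := by
    simp only [map_add, AddSubgroup.coe_add, Complex.ofReal_add]
    ring
  map_smul' c x := by
    simp only [realPart_smul, imaginaryPart_smul, AddSubgroup.coe_add, AddSubgroupClass.coe_sub,
      selfAdjoint.val_smul, map_add, map_sub, map_smul, smul_eq_mul, RingHom.id_apply,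
      Complex.ofReal_add, Complex.ofReal_sub, Complex.ofReal_mul]
    apply Complex.ext <;> simp 

theorem complexify_of_isSelfAdjoint (g : B →ₗ[ℝ] ℝ) {x : B} (hx : IsSelfAdjoint x) :
    complexify g x = g x := by
  change (g (ℜ x : B) : ℂ) + g (ℑ x : B) * Complex.I = _
  rw [hx.coe_realPart, hx.imaginaryPart]
  simp

variable [PartialOrder B] [StarOrderedRing B]

/-- Positive functionals separate the points of a C*-algebra. -/
theorem exists_positive_ne_zero {a : B} (ha : a ≠ 0) : ∃ f : B →ₚ[ℂ] ℂ, f (star a * a) ≠ 0 := by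
  have h : -(star a * a) ∉ ProperCone.positive ℝ B := by
    intro h
    have h1 : 0 ≤ -(star a * a) := h
    have h2 := le_antisymm (neg_nonneg.1 h1) (star_mul_self_nonneg a)
    exact ha (CStarRing.star_mul_self_eq_zero_iff a |>.1 h2)
  -- Hahn–Banach separation: `g` is nonnegative on the positive cone and negative at `-(a* a)`.
  obtain ⟨g, hg, hga⟩ := (ProperCone.positive ℝ B).hyperplane_separation_point h
  refine ⟨PositiveLinearMap.mk₀ (complexify g) fun x hx => ?_, ?_⟩
  · rw [complexify_of_isSelfAdjoint _ (IsSelfAdjoint.of_nonneg hx)]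
    exact Complex.zero_le_real.2 (hg x hx)
  · change complexify g (star a * a) ≠ 0
    rw [complexify_of_isSelfAdjoint _ (.star_mul_self a), Complex.ofReal_ne_zero]
    intro h0
    have h0 : g (star a * a) = 0 := h0
    rw [map_neg, h0, neg_zero] at hga
    exact lt_irrefl _ hga

/-- The cyclic vector, the class of `1`, is mapped to the class of `a`, whose squared norm is `f(a*
a)`. -/
theorem gnsStarAlgHom_ne_zero (f : B →ₚ[ℂ] ℂ) {a : B} (h : f (star a * a) ≠ 0) :
    f.gnsStarAlgHom a ≠ 0 := by
  intro h0
  have h1 : f.gnsStarAlgHom a (f.toPreGNS 1 : f.GNS) = (f.toPreGNS a : f.GNS) := by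
    change f.gnsNonUnitalStarAlgHom a _ = _
    simp
  rw [h0, zero_apply] at h1
  have h2 := f.preGNS_norm_sq (f.toPreGNS a)
  rw [← UniformSpace.Completion.norm_coe (E := f.PreGNS), ← h1] at h2
  apply h
  simpa using h2.symm

variable (B) in
/-- The Hilbert space of the universal representation. -/
abbrev UniversalSpace : Type _ := lp (fun f : B →ₚ[ℂ] ℂ => f.GNS) 2

variable (B) in
/-- The universal representation, the direct sum of all GNS representations. -/
def universalRep : B →⋆ₐ[ℂ] (UniversalSpace B →L[ℂ] UniversalSpace B) where
  toFun a := lp.mapCLM 2 (fun f : B →ₚ[ℂ] ℂ => f.gnsStarAlgHom a) (norm_nonneg a)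
    fun f => NonUnitalStarAlgHom.norm_apply_le f.gnsStarAlgHom a
  map_one' := by ext x f; simp
  map_mul' a b := by ext x f; simp
  map_zero' := by ext x f; simp
  map_add' a b := by ext x f; simp
  commutes' c := by
    ext x f
    change f.gnsStarAlgHom (algebraMap ℂ B c) (x f) = c • x f
    rw [AlgHomClass.commutes]
    rfl
  map_star' a := by
    rw [ContinuousLinearMap.star_eq_adjoint, ContinuousLinearMap.eq_adjoint_iff]
    intro x y
    rw [lp.inner_eq_tsum, lp.inner_eq_tsum]
    refine tsum_congr fun f => ?_
    change inner ℂ (f.gnsStarAlgHom (star a) (x f)) (y f) =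
      inner ℂ (x f) (f.gnsStarAlgHom a (y f))
    rw [map_star, ContinuousLinearMap.star_eq_adjoint, ContinuousLinearMap.adjoint_inner_left]

theorem injective_universalRep : Function.Injective (universalRep B) := by
  classical
  rw [injective_iff_map_eq_zero]
  intro a h
  by_contra ha
  obtain ⟨f, hf⟩ := exists_positive_ne_zero ha
  refine gnsStarAlgHom_ne_zero f hf ?_
  ext1 ξ
  have := congrArg (fun x : UniversalSpace B => x f)
    (DFunLike.congr_fun h (lp.single 2 f ξ))
  have h2 : f.gnsStarAlgHom a ((lp.single 2 f ξ : UniversalSpace B) f) = 0 := this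
  rwa [lp.single_apply_self] at h2

end GNS

/-- Every C*-algebra has a faithful representation on a Hilbert space `ℓ²(ι)`. -/
theorem exists_faithful_rep (B : Type u) [CStarAlgebra B] :
    ∃ (ι : Type u) (ρ : B →⋆ₐ[ℂ] Op ι), Function.Injective ρ := by
  let _ := CStarAlgebra.spectralOrder B
  have _ := CStarAlgebra.spectralOrderedRing B
  obtain ⟨w, b, -⟩ := exists_hilbertBasis ℂ (UniversalSpace B)
  let e : (UniversalSpace B →L[ℂ] UniversalSpace B) →⋆ₐ[ℂ] Op w := b.repr.conjStarAlgEquiv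
  have he : Function.Injective e := EquivLike.injective b.repr.conjStarAlgEquiv
  exact ⟨w, e.comp (universalRep B), he.comp injective_universalRep⟩

theorem homog_uzpow_shift (k : ℤ) : Homog id k (uzpow shift k) := by
  refine Homog.of_phase_comm fun w f => ?_
  ext m
  rw [phase_apply, uzpow_shift_apply, lp.coeFn_smul, Pi.smul_apply, uzpow_shift_apply, phase_apply,
    smul_eq_mul, ← mul_assoc, ← Circle.coe_mul, ← zpow_add]
  simp

theorem homog_zero {ι : Type*} (b : Op ι) : Homog 0 0 b := by
  have h : ∀ (w : Circle) (f : L2 ι), phase 0 w f = f := fun w f => by ext i; simp [phase_apply]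
  exact Homog.of_phase_comm fun w f => by simp [h]

namespace Datum

variable {n : ℕ} {P : Datum n}

/-- Twisting by the powers of a commuting unitary preserves the defining relations. -/
theorem Relations.twist {D : Type*} [Ring D] [StarRing D] [Algebra ℂ D] [StarModule ℂ D]
    {t : Fin n → Fin n → D} (ht : P.Relations t) {c : ℤ → D} (h0 : c 0 = 1)
    (hadd : ∀ k l, c (k + l) = c k * c l) (hstar : ∀ k, star (c k) = c (-k))
    (hcomm : ∀ k i j, t i j * c k = c k * t i j) :
    P.Relations fun i j => c (P.deg j - P.deg i) * t i j := by
  have hcomm' : ∀ k i j, star (t i j) * c k = c k * star (t i j) := fun k i j => by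
    have := congrArg star (hcomm (-k) i j)
    rw [star_mul, star_mul, hstar, neg_neg] at this
    exact this.symm
  refine ⟨fun i j => ?_, fun i j => ?_, fun i j => ?_⟩
  · have : ∀ k, star (c (P.deg i - P.deg k) * t k i) * (c (P.deg j - P.deg k) * t k j) =
        c (P.deg j - P.deg i) * (star (t k i) * t k j) := by
      intro k
      rw [star_mul, hstar, mul_assoc, ← mul_assoc (c _) (c _), ← hadd, ← mul_assoc, hcomm',
        mul_assoc]
      congr 2; ring
    simp only [this, ← Finset.mul_sum, ht.isometry]
    split_ifs with h
    · subst h; rw [sub_self, h0, mul_one]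
    · rw [mul_zero]
  · have : ∀ k, (c (P.deg k - P.deg i) * t i k) * star (c (P.deg k - P.deg j) * t j k) =
        c (P.deg j - P.deg i) * (t i k * star (t j k)) := by
      intro k
      rw [star_mul, hstar, hcomm', mul_assoc, ← mul_assoc (t i k), hcomm, mul_assoc, ← mul_assoc,
        ← hadd]
      congr 2; ring
    simp only [this, ← Finset.mul_sum, ht.coisometry]
    split_ifs with h
    · subst h; rw [sub_self, h0, mul_one]
    · rw [mul_zero]
  -- Where `ω_ik ≠ 0`, one has `d_k = d - d_i`, so the exponent does not depend on `k` and the twist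
  -- factors out of the sum; similarly for the other side.
  · have h1 : ∀ k, P.ω i k • (c (P.deg k - P.deg j) * t j k) =
        c (P.d - P.deg i - P.deg j) * (P.ω i k • t j k) := by
      intro k
      by_cases h : P.ω i k = 0
      · simp [h]
      · rw [mul_smul_comm, ← P.homogeneous i k h]
        congr 3; ring
    have h2 : ∀ k, P.ω k j • star (c (P.deg i - P.deg k) * t k i) =
        c (P.d - P.deg i - P.deg j) * (P.ω k j • star (t k i)) := by
      intro k
      by_cases h : P.ω k j = 0
      · simp [h]
      · rw [star_mul, hstar, hcomm', mul_smul_comm, ← P.homogeneous k j h]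
        congr 3; ring
    simp only [h1, h2, ← Finset.mul_sum]
    rw [← mul_smul_comm, ht.invariant, mul_smul_comm]

/-! ### Making a faithful representation covariant -/

section Covariant

variable {ι : Type*} (ρ : P.Ao →⋆ₐ[ℂ] Op ι)

/-- The powers of the shift on `ℓ²(ℤ) ⊗ ℓ²(ι)`. -/
def ampShift (ι : Type*) (k : ℤ) : Op (ℤ × ι) := amp ι (uzpow shift k)

theorem ampShift_zero : ampShift ι 0 = 1 := map_one (ampHom ι)

theorem ampShift_add (k l : ℤ) : ampShift ι (k + l) = ampShift ι k * ampShift ι l := by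
  rw [ampShift, uzpow_add star_shift_mul_shift shift_mul_star_shift]
  exact map_mul (ampHom ι) _ _

theorem star_ampShift (k : ℤ) : star (ampShift ι k) = ampShift ι (-k) := by
  rw [ampShift, ampShift, ← star_uzpow star_shift_mul_shift shift_mul_star_shift]
  exact (map_star (ampHom ι) _).symm

/-- The representation on the second factor of `ℓ²(ℤ) ⊗ ℓ²(ι)`. -/
def rightRep : P.Ao →⋆ₐ[ℂ] Op (ℤ × ι) := (braidedHom 1 id 0).comp ρ

theorem rightRep_mul_ampShift (b : P.Ao) (k : ℤ) :
    rightRep ρ b * ampShift ι k = ampShift ι k * rightRep ρ b := by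
  have h := (homog_zero (ρ b)).braidedAmp_mul_amp (ζ := 1) (homog_uzpow_shift k)
  rw [one_zpow, Circle.coe_one, one_smul] at h
  exact h

/-- This is `ρ` composed with the coaction `b ↦ z^k ⊗ b` on elements of degree `k`; the grading of
`ℓ²(ℤ)` then implements the action. -/
theorem exists_twist : ∃ π : P.Ao →⋆ₐ[ℂ] Op (ℤ × ι), ∀ i j,
    π (P.u i j) = ampShift ι (P.deg j - P.deg i) * rightRep ρ (P.u i j) :=
  P.exists_lift _ ((P.u_relations.map (rightRep ρ)).twist ampShift_zero ampShift_add star_ampShift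
    fun k i j => rightRep_mul_ampShift ρ (P.u i j) k)

/-- The star polynomials of degree `k`, with respect to a representation `π` and a representation
`ρ`. -/
def twistGrading (π : P.Ao →⋆ₐ[ℂ] Op (ℤ × ι)) (k : ℤ) : Submodule ℂ (Free n) where
  carrier := {x | π (P.toAo x) = ampShift ι k * rightRep ρ (P.toAo x)}
  add_mem' {x y} hx hy := by
    simp only [Set.mem_ofPred_eq, map_add, mul_add] at hx hy ⊢
    rw [hx, hy]
  zero_mem' := by simp
  smul_mem' r x hx := by
    simp only [Set.mem_ofPred_eq, map_smul, mul_smul_comm] at hx ⊢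
    rw [hx]

variable {ρ} {π : P.Ao →⋆ₐ[ℂ] Op (ℤ × ι)}

/-- The comparison of norms for graded algebras, with `B` as dominated algebra: in degree `k`, `π`
is the shift by `k` times the untwisted representation, so the lower bound for shifts with `ζ = 1`
applies. -/
theorem norm_le_norm_twist (hρ : Function.Injective ρ) (hπ : ∀ i j,
    π (P.u i j) = ampShift ι (P.deg j - P.deg i) * rightRep ρ (P.u i j)) (b : P.Ao) :
    ‖b‖ ≤ ‖π b‖ := by
  have hmul : ∀ k l x y, x ∈ twistGrading ρ π k → y ∈ twistGrading ρ π l →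
      x * y ∈ twistGrading ρ π (k + l) := by
    intro k l x y hx hy
    change π (P.toAo (x * y)) = _
    rw [map_mul, map_mul, show π (P.toAo x) = _ from hx, show π (P.toAo y) = _ from hy, mul_assoc,
      ← mul_assoc (rightRep ρ _) (ampShift ι l), rightRep_mul_ampShift, ampShift_add, map_mul]
    simp only [mul_assoc]
  have hone : 1 ∈ twistGrading ρ π 0 := by
    change π (P.toAo 1) = _
    rw [map_one, map_one, map_one, ampShift_zero, one_mul]
  have hstar : ∀ k x, x ∈ twistGrading ρ π k → star x ∈ twistGrading ρ π (-k) := by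
    intro k x hx
    change π (P.toAo (star x)) = _
    rw [map_star, map_star, show π (P.toAo x) = _ from hx, star_mul, star_ampShift, ← map_star,
      rightRep_mul_ampShift]
  have hgen : ∀ x, ∃ k, FreeStar.gen x ∈ twistGrading ρ π k := fun x => ⟨_, hπ x.1 x.2⟩
  have hkey : ∀ (s : Finset ℤ) (x : ∀ k, twistGrading ρ π k),
      ‖∑ k ∈ s, star (P.toAo (x k)) * P.toAo (x k)‖ ≤
        ‖(π.comp P.toAo) (∑ k ∈ s, (x k : Free n))‖ ^ 2 := by
    intro s x
    rw [← NonUnitalStarAlgHom.norm_map ρ hρ, map_sum, map_sum]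
    simp only [map_mul, map_star]
    refine (norm_sum_star_mul_le (ζ := 1) (q := 0) s _).trans_eq ?_
    congr 2
    exact Finset.sum_congr rfl fun k _ => (x k).2.symm
  have hd : DenseRange P.toAo := P.seminorm.denseRange_toCompl
  refine hd.induction_on (p := fun b => ‖b‖ ≤ ‖π b‖) b
    (isClosed_le continuous_norm (continuous_starAlgHom π).norm) fun x => ?_
  obtain ⟨M, hM⟩ := exists_mem_window hmul hone hstar hgen x
  exact norm_le_of_grading P.toAo (π.comp P.toAo) hmul hone hstar hkey hM

end Covariant

variable (P) in
theorem nonempty_covariantRep : Nonempty (CovariantRep.{0} P.act) := by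
  obtain ⟨ι, ρ, hρ⟩ := exists_faithful_rep P.Ao
  obtain ⟨π, hπ⟩ := exists_twist ρ
  -- The vector `δ_m ⊗ δ_i` has degree `m`. The zero degree of the second factor is kept so that the
  -- grading has the form of a total degree.
  refine ⟨⟨ℤ × ι, fun x => id x.1 + (0 : ι → ℤ) x.2, π, ?_, fun w b => ?_⟩⟩
  · rw [injective_iff_map_eq_zero]
    intro b hb
    have := norm_le_norm_twist hρ hπ b
    rwa [hb, norm_zero, norm_le_zero_iff] at this
  · have : π.comp (P.act w) =
        (conjHom (phase (fun x : ℤ × ι => id x.1 + (0 : ι → ℤ) x.2) w)).comp π := by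
      refine P.hom_ext fun i j => ?_
      have h := ((homog_uzpow_shift (P.deg j - P.deg i)).amp (q := (0 : ι → ℤ))).mul
        ((homog_zero (ρ (P.u i j))).braidedAmp (p := id) (ζ := 1)) w
      rw [add_zero] at h
      rw [StarAlgHom.comp_apply, act_u, map_smul, StarAlgHom.comp_apply, hπ]
      exact h.symm
    exact DFunLike.congr_fun this b

end Datum

end BraidedFree

end

theorem mainTheorem5 {n : ℕ} (P : Datum n) :
    Nonempty (CovariantRep.{0} P.act) ∧
    ∀ R : CovariantRep.{u} P.act,
      -- the bosonisation is the universal C*-algebra with the stated generators and relations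
      (P.BosRelations (P.bosZ R) (P.bosU R) ∧
        ∀ (D : Type v) [CStarAlgebra D] (z : D) (t : Fin n → Fin n → D), P.BosRelations z t →
          ∃! φ : R.bos P.ζ →⋆ₐ[ℂ] D, φ (P.bosZ R) = z ∧ ∀ i j, φ (P.bosU R i j) = t i j) ∧
      -- it is the closed linear span of the products of the two factors
      Dense (Submodule.span ℂ
        {x : R.bos P.ζ | ∃ a b, x = R.bos₁ P.ζ a * R.bos₂ P.ζ b} : Set (R.bos P.ζ)) ∧
      -- the comultiplications exist and are given by the stated formulas
      (∃! Δ : P.Ao →⋆ₐ[ℂ] R.box P.ζ, P.IsComult R Δ) ∧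
      ∀ Δ : P.Ao →⋆ₐ[ℂ] R.box P.ζ, P.IsComult R Δ →
        (∃! ΔC, R.IsBosonisationComult P.ζ Δ ΔC) ∧
        ∀ ΔC, R.IsBosonisationComult P.ζ Δ ΔC →
          ΔC (P.bosZ R) = tmul (P.bosZ R) (P.bosZ R) ∧
          ∀ i k, ΔC (P.bosU R i k) =
            ∑ l, tmul (P.bosU R i l) (uzpow (P.bosZ R) (P.deg l - P.deg i) * P.bosU R l k) := by
  refine ⟨P.nonempty_covariantRep, fun R => ⟨⟨Datum.bos_relations R, fun D _ z t h => ?_⟩,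
    Datum.dense_span_bos R, Datum.existsUnique_comult R, fun Δ hΔ =>
      ⟨Datum.existsUnique_bosonisationComult R hΔ, fun ΔC hC =>
        Datum.bosonisationComult_apply hΔ hC⟩⟩⟩
  obtain ⟨φ, h1, h2⟩ := Datum.exists_bos_lift R h
  exact ⟨φ, ⟨h1, h2⟩, fun φ' h' => Datum.bos_hom_ext R (h'.1.trans h1.symm)
    fun i j => (h'.2 i j).trans (h2 i j).symm⟩
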